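/- **Theorem 1.1.** Let $U$ be a neighbourhood of the origin in $\mathbb{R}^2$ and let $\Phi:U\to\mathbb{R}^2$, $(x,y)\mapsto(X,Y)$, be a $C^\infty$ map such that, as $(x,y)\to(0,0)$, $$X = x + x^2+\mu xy + O(|(x,y)|^3),\qquad Y = - y + \lambda xy + O(|(x,y)|^3),$$ where $\mu\in\mathbb{R}$ and $\lambda>0$. Then $\Phi$ is injective on some neighbourhood $V\subset U$ of the origin. Moreover, fix any neighbourhood $V\subset U$ of the origin on which $\Phi$ is injective, let $\Phi^{-1}:\Phi(V)\to V$ be the inverse of $\Phi|_V$, and for $S\subset\mathbb{R}^2$ write $\Phi^{-1}(S)=\{q\in V:\Phi(q)\in S\}$. Then there exist $\delta>0$ and a function $F\in C^\infty([0,\delta])$ whose graph $\Gamma=\{(x,F(x)):x\in[0,\delta]\}$ is contained in $U$ and which has the following properties. (I) Invariance: $\Gamma\subset\Phi(V)$ and $\Phi^{-1}(\Gamma)\subset\Gamma$. (II) Tangency: $F(x)=O(x^3)$ as $x\to0^+$, and $F(0)=0$. (III) Uniqueness: Let $\tilde\delta>0$, let $\tilde F:[0,\tilde\delta]\to\mathbb{R}$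 be any function, and let $\tilde\Gamma=\{(x,\tilde F(x)):x\in[0,\tilde\delta]\}$. If $\Phi^{-1}(\tilde\Gamma)\subset\tilde\Gamma$ and $x^{-2/3}\tilde F(x)\to0$ as $x\to0^+$, then there is $\delta^{\#}\in(0,\min(\delta,\tilde\delta)]$ such that $\tilde F=F$ on $(0,\delta^{\#}]$; if in addition $\tilde F(0)=0$, then $\tilde F=F$ on $[0,\delta^{\#}]$. -/

import Mathlib

open Set Filter Topology Asymptotics
open scoped ContDiff

/-- `Φ = (X, Y)` has the form `X = x + x² + μxy + O(|(x,y)|³)`, `Y = -y + λxy + O(|(x,y)|³)` at the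
origin.  (The norm of `ℝ × ℝ` is equivalent to the Euclidean one, so the `O` terms are the same.) -/
def HasDegenerateForm (Φ : ℝ × ℝ → ℝ × ℝ) (μ lam : ℝ) : Prop :=
  ((fun p : ℝ × ℝ => (Φ p).1 - (p.1 + p.1 ^ 2 + μ * p.1 * p.2)) =O[𝓝 0] fun p => ‖p‖ ^ 3) ∧
  ((fun p : ℝ × ℝ => (Φ p).2 - (-p.2 + lam * p.1 * p.2)) =O[𝓝 0] fun p => ‖p‖ ^ 3)

/-- `V` is a neighbourhood of the origin inside the domain `U` on which `Φ` is one-to-one, so that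
the inverse map `Φ⁻¹ : Φ(V) → V` makes sense. -/
structure IsInversionDomain (Φ : ℝ × ℝ → ℝ × ℝ) (U V : Set (ℝ × ℝ)) : Prop where
  nhds_zero : V ∈ 𝓝 (0 : ℝ × ℝ)
  subset : V ⊆ U
  injOn : InjOn Φ V

/-- The image of `S` (precisely, of its part lying in `Φ(V)`) under the inverse map
`Φ⁻¹ : Φ(V) → V`. -/
def inverseImageOn (Φ : ℝ × ℝ → ℝ × ℝ) (V S : Set (ℝ × ℝ)) : Set (ℝ × ℝ) :=
  {q | q ∈ V ∧ Φ q ∈ S}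

/-! Existence. In the chart `y = x w` the map becomes X = x + x²α, W = -w + xβ, slowly expanding in
x and, up to a reflection, slowly contracting in w: a weak saddle. Iterating the graph transform
from the zero curve gives z₀, z₁, … . The difference z_{n+2} - z_{n+1} at X is at most z_{n+1} - z_n
at the preceding abscissa x. Each backward step raises 1/x by at least 1/4 and z₁ = O(x²), so the
differences are O(1/n²) uniformly and the iterates converge to an invariant curve
(`WeakSaddle.exists_iterates_dist`, `WeakSaddle.exists_limit`).

Regularity. If z is invariant, so is the pair (z, ε x z') for a system on E × E that is again a weak
saddle when ε is small (`WeakSaddle.exists_prolong`). Induction over k, with E varying, controls k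
derivatives, each at the cost of one factor x (`WeakSaddle.limit_regular`). These factors are
recovered beforehand: the substitution z = a x² + x w gives a new weak saddle
(`WeakSaddle.exists_shift`), and repeating it writes the curve as a smooth function plus a high
power of x times a limit curve. This yields, for every k, a `C^k` invariant curve with F = O(x³).

Uniqueness. The function Λ = x + (μ/2)xy grows by at least x²/2 along a curve that is o(x^(2/3)),
because the reflection of y cancels the term μxy. Backward orbits therefore tend to the origin.
Forward iteration does not increase the vertical distance to the graph of F, since the cubic
remainder has Lipschitz constant O(r^(3/2)) = o(x), dominated by the contraction λx. So the distance
at x is at most its limit along the backward orbit, which is 0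
(`HasDegenerateForm.eventually_eq_of_backward`).

Assembly. By uniqueness the `C^k` curves all agree with one F near 0, on ranges depending on k.
Invariance carries the smoothness outward to a fixed interval (`contDiffAt_of_invariant`). -/

section Class

/-! ### Weak saddles and their prolongation to Euler derivatives. -/

variable {E : Type} [NormedAddCommGroup E] [NormedSpace ℝ E]

/-- The skew system `X = x + x² α(x, z)`, `Z = -z + x β(x, z)` on `ℝ × E` is weakly expanding in `x`
and weakly contracting (up to a reflection) in `z`. -/
structure WeakSaddle (α : ℝ × E → ℝ) (β : ℝ × E → E) : Prop where
  smooth_fst : ∀ᶠ p in 𝓝 0, ContDiffAt ℝ ∞ α p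
  smooth_snd : ∀ᶠ p in 𝓝 0, ContDiffAt ℝ ∞ β p
  fst_zero : α 0 = 1
  snd_zero : β 0 = 0
  contracting : ∃ c > 0, ∀ᶠ t : ℝ in 𝓝[>] 0, ∀ z : E,
    ‖z - t • fderiv ℝ β 0 (0, z)‖ ≤ (1 - c * t) * ‖z‖

/-- The first coordinate of the system along the graph of `z`. -/
def baseMap (α : ℝ × E → ℝ) (z : ℝ → E) (x : ℝ) : ℝ := x + x ^ 2 * α (x, z x)

/-- The second coordinate of the system along the graph of `z`. -/
def fibreMap (β : ℝ × E → E) (z : ℝ → E) (x : ℝ) : E := -z x + x • β (x, z x)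

/-- `f + (x ∂ₓ f + ∂_z f · q)`: along a curve `z` with `q = x z'` this is the derivative of
`x f`. -/
noncomputable def eulerDeriv {F : Type} [NormedAddCommGroup F] [NormedSpace ℝ F] (f : ℝ × E → F)
    (p : ℝ × E) (q : E) : F := f p + fderiv ℝ f p (p.1, q)

/-- First component of the system satisfied by a curve together with its Euler derivative. -/
def prolongFst (α : ℝ × E → ℝ) (p : ℝ × E × E) : ℝ := α (p.1, p.2.1)

/-- Second component of the system satisfied by `(z, ε x z')` when `z` is an invariant curve. -/
noncomputable def prolongSnd (ε : ℝ) (α : ℝ × E → ℝ) (β : ℝ × E → E) (p : ℝ × E × E) : E × E :=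
  (β (p.1, p.2.1),
    (1 + p.1 * α (p.1, p.2.1) + p.1 * eulerDeriv α (p.1, p.2.1) (ε⁻¹ • p.2.2))⁻¹ •
      (ε • ((1 + p.1 * α (p.1, p.2.1)) • eulerDeriv β (p.1, p.2.1) (ε⁻¹ • p.2.2) +
        eulerDeriv α (p.1, p.2.1) (ε⁻¹ • p.2.2) • (ε⁻¹ • p.2.2))))

theorem contDiffAt_eulerDeriv {F G : Type} [NormedAddCommGroup F] [NormedSpace ℝ F]
    [NormedAddCommGroup G] [NormedSpace ℝ G] {f : ℝ × E → F} {b : G → ℝ × E} {q : G → E} {p : G}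
    (hf : ContDiffAt ℝ ∞ f (b p)) (hb : ContDiffAt ℝ ∞ b p) (hq : ContDiffAt ℝ ∞ q p) :
    ContDiffAt ℝ ∞ (fun p => eulerDeriv f (b p) (q p)) p := by
  have h1 : ContDiffAt ℝ ∞ (fun p => f (b p)) p := hf.comp p hb
  have h2 : ContDiffAt ℝ ∞ (fun p => fderiv ℝ f (b p)) p :=
    (hf.fderiv_right (m := ∞) (by simp)).comp p hb
  exact h1.add (h2.clm_apply (hb.fst.prodMk hq))

theorem exists_forall_of_eventually_nhds_zero {E : Type} [NormedAddCommGroup E] {P : ℝ × E → Prop}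
    (h : ∀ᶠ p in 𝓝 0, P p) :
    ∃ ρ > 0, ∀ x z, |x| < ρ → ‖z‖ < ρ → P (x, z) := by
  obtain ⟨ρ, hρ, h⟩ := Metric.eventually_nhds_iff.1 h
  refine ⟨ρ, hρ, fun x z hx hz => h ?_⟩
  rw [dist_zero_right, Prod.norm_def]
  exact max_lt hx hz

theorem eventually_prolong_arg {E : Type} [NormedAddCommGroup E] {P : ℝ × E → Prop}
    (h : ∀ᶠ p in 𝓝 0, P p) :
    ∀ᶠ p : ℝ × E × E in 𝓝 0, P (p.1, p.2.1) := by
  have : Tendsto (fun p : ℝ × E × E => (p.1, p.2.1)) (𝓝 0) (𝓝 0) :=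
    (by fun_prop : Continuous fun p : ℝ × E × E => (p.1, p.2.1)).tendsto' _ _ rfl
  exact this.eventually h

namespace WeakSaddle

variable {α : ℝ × E → ℝ} {β : ℝ × E → E}

/-- Strict differentiability of β at 0 replaces β by its linear part at the cost of half of the
contraction rate. -/
theorem exists_contraction (h : WeakSaddle α β) : ∃ c > 0, ∃ ρ > 0, ∀ x z z', 0 < x → x < ρ →
    ‖z‖ < ρ → ‖z'‖ < ρ →
      ‖(-z + x • β (x, z)) - (-z' + x • β (x, z'))‖ ≤ (1 - c * x) * ‖z - z'‖ := by
  obtain ⟨c, hc, hcon⟩ := h.contracting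
  have hd := (h.smooth_snd.self_of_nhds).hasStrictFDerivAt (by simp)
  have h1 := (hasStrictFDerivAt_iff_isLittleO.1 hd).def (half_pos hc)
  rw [← Prod.zero_eq_mk, Metric.eventually_nhds_iff] at h1
  obtain ⟨ρ₁, hρ₁, h1⟩ := h1
  obtain ⟨ρ₂, hρ₂, h2⟩ := mem_nhdsGT_iff_exists_Ioo_subset.1 hcon
  refine ⟨c / 2, half_pos hc, min ρ₁ ρ₂, lt_min hρ₁ hρ₂, fun x z z' hx hxρ hz hz' => ?_⟩
  have e1 : ‖β (x, z) - β (x, z') - fderiv ℝ β 0 (0, z - z')‖ ≤ c / 2 * ‖z - z'‖ := by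
    have := @h1 ((x, z), (x, z')) (by
      simp only [dist_zero_right, Prod.norm_def, Real.norm_eq_abs, abs_of_pos hx, max_lt_iff]
      simp_all)
    simpa [Prod.norm_def] using this
  have e2 := h2 ⟨hx, hxρ.trans_le (min_le_right _ _)⟩ (z - z')
  have : (-z + x • β (x, z)) - (-z' + x • β (x, z')) =
      -((z - z') - x • fderiv ℝ β 0 (0, z - z'))
        + x • (β (x, z) - β (x, z') - fderiv ℝ β 0 (0, z - z')) := by module
  rw [this]
  refine (norm_add_le _ _).trans ?_
  rw [norm_neg, norm_smul, Real.norm_eq_abs, abs_of_pos hx]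
  nlinarith [mul_le_mul_of_nonneg_left e1 hx.le]

/-- The contraction loses c x r on the sphere of radius r, while the inhomogeneous term x β(x, 0) is
smaller than c x r because β vanishes at 0. -/
theorem exists_invariant_ball (h : WeakSaddle α β) : ∃ ρ > 0, ∀ r, 0 < r → r < ρ → ∃ δ > 0,
    ∀ x z, 0 < x → x < δ → ‖z‖ ≤ r → ‖-z + x • β (x, z)‖ ≤ r := by
  obtain ⟨c, hc, ρ, hρ, h1⟩ := h.exists_contraction
  refine ⟨ρ, hρ, fun r hr hrρ => ?_⟩
  have h2 : ∀ᶠ p in 𝓝 (0 : ℝ × E), ‖β p‖ < c * r :=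
    h.smooth_snd.self_of_nhds.continuousAt.norm.eventually_lt continuousAt_const
      (by rw [h.snd_zero, norm_zero]; positivity)
  obtain ⟨δ, hδ, h2⟩ := exists_forall_of_eventually_nhds_zero h2
  refine ⟨min δ (min ρ (1 / c)), by positivity, fun x z hx hxδ hz => ?_⟩
  have hxρ := (hxδ.trans_le (min_le_right _ _)).trans_le (min_le_left _ _)
  have e1 := h1 x z 0 hx hxρ (hz.trans_lt hrρ) (by simpa)
  have e2 := h2 x 0 (by rw [abs_of_pos hx]; exact hxδ.trans_le (min_le_left _ _)) (by simpa)
  have e3 : ‖-z + x • β (x, z)‖ ≤ (1 - c * x) * ‖z‖ + x * ‖β (x, 0)‖ := by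
    have : -z + x • β (x, z) =
        ((-z + x • β (x, z)) - (-0 + x • β (x, (0 : E)))) + x • β (x, 0) := by
      module
    rw [this]
    refine (norm_add_le _ _).trans ?_
    rw [norm_smul, Real.norm_eq_abs, abs_of_pos hx]
    simpa using e1
  have hcx : c * x ≤ 1 := by
    have := (hxδ.trans_le (min_le_right _ _)).trans_le (min_le_right _ _)
    rw [lt_div_iff₀ hc] at this
    linarith
  nlinarith [norm_nonneg z, mul_le_mul_of_nonneg_left e2.le hx.le]

/-- The derivative is read off along the line t(0, z, p), where the denominator in `prolongSnd` is
1. The result is block triangular; the extra p comes from α(0) = 1 and strengthens the contraction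
in the second block. -/
theorem fderiv_prolongSnd_zero (h : WeakSaddle α β) {ε : ℝ} (hε : ε ≠ 0)
    (hd : DifferentiableAt ℝ (prolongSnd ε α β) 0) (z p : E) :
    fderiv ℝ (prolongSnd ε α β) 0 (0, z, p) = (fderiv ℝ β 0 (0, z),
      ε • fderiv ℝ β 0 (0, z) + fderiv ℝ β 0 (0, p) + p) := by
  have hβ := h.smooth_snd.self_of_nhds
  have hα := h.smooth_fst.self_of_nhds
  have hline : HasDerivAt (fun t : ℝ => t • ((0 : ℝ), z, p)) (0, z, p) 0 := by
    simpa using (hasDerivAt_id (0 : ℝ)).smul_const ((0 : ℝ), z, p)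
  have hlz : HasDerivAt (fun t : ℝ => ((0 : ℝ), t • z)) (0, z) 0 :=
    (hasDerivAt_const _ _).prodMk (by simpa using (hasDerivAt_id (0 : ℝ)).smul_const z)
  have hcomp := HasFDerivAt.comp_hasDerivAt_of_eq (0 : ℝ) hd.hasFDerivAt hline (by simp)
  refine hcomp.unique ?_
  have hsmul : ∀ {G : Type} [NormedAddCommGroup G] [NormedSpace ℝ G] (k : ℝ → G),
      DifferentiableAt ℝ k 0 → HasDerivAt (fun t : ℝ => t • k t) (k 0) 0 := by
    intro G _ _ k hk
    simpa using (hasDerivAt_id' (0 : ℝ)).fun_smul hk.hasDerivAt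
  have e1 : HasDerivAt (fun t : ℝ => β (0, t • z)) (fderiv ℝ β 0 (0, z)) 0 :=
    HasFDerivAt.comp_hasDerivAt_of_eq (0 : ℝ) (hβ.differentiableAt (by simp)).hasFDerivAt hlz
      (by simp [← Prod.zero_eq_mk])
  have e2 : ∀ {G : Type} [NormedAddCommGroup G] [NormedSpace ℝ G] (f : ℝ × E → G),
      ContDiffAt ℝ ∞ f 0 → HasDerivAt (fun t : ℝ => t • fderiv ℝ f (0, t • z) (0, ε⁻¹ • p))
      (fderiv ℝ f 0 (0, ε⁻¹ • p)) 0 := by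
    intro G _ _ f hf
    have : DifferentiableAt ℝ (fun t : ℝ => fderiv ℝ f (0, t • z) (0, ε⁻¹ • p)) 0 := by
      have h1 : DifferentiableAt ℝ (fderiv ℝ f) ((0 : ℝ), (0 : ℝ) • z) := by
        rw [zero_smul, ← Prod.zero_eq_mk]
        exact (hf.fderiv_right (m := ∞) (by simp)).differentiableAt (by simp)
      exact (h1.comp (0 : ℝ) hlz.differentiableAt).clm_apply (differentiableAt_const _)
    simpa [← Prod.zero_eq_mk] using hsmul _ this
  have e3 : HasDerivAt (fun t : ℝ => t • (α (0, t • z) • (ε⁻¹ • p)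
      + (t • fderiv ℝ α (0, t • z) (0, ε⁻¹ • p)) • (ε⁻¹ • p))) (ε⁻¹ • p) 0 := by
    have : DifferentiableAt ℝ (fun t : ℝ => α (0, t • z) • (ε⁻¹ • p)
        + (t • fderiv ℝ α (0, t • z) (0, ε⁻¹ • p)) • (ε⁻¹ • p)) 0 := by
      refine .add (.smul_const ?_ _) (.smul_const (e2 α hα).differentiableAt _)
      exact (HasFDerivAt.comp_hasDerivAt_of_eq (0 : ℝ)
        (hα.differentiableAt (by simp)).hasFDerivAt hlz
        (by simp [← Prod.zero_eq_mk])).differentiableAt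
    simpa [← Prod.zero_eq_mk, h.fst_zero] using hsmul _ this
  have e4 := e1.prodMk (((e1.add (e2 β hβ)).add e3).const_smul ε)
  refine (e4.congr_deriv ?_).congr_of_eventuallyEq (.of_forall fun t => ?_)
  rotate_left
  · have h1 : ((0 : ℝ), t • ε⁻¹ • p) = t • ((0 : ℝ), ε⁻¹ • p) := by simp
    have h2 : ε⁻¹ • t • p = t • ε⁻¹ • p := smul_comm _ _ _
    simp only [Function.comp, prolongSnd, eulerDeriv, Prod.smul_mk, smul_zero, zero_mul, add_zero,
      inv_one, one_smul, h2]
    simp only [h1, map_smul, Pi.add_apply, Pi.smul_apply, smul_eq_mul]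
    congr 2
    module
  · have h1 : ((0 : ℝ), ε⁻¹ • p) = ε⁻¹ • ((0 : ℝ), p) := by simp
    rw [h1, map_smul, smul_add, smul_add, smul_inv_smul₀ hε, smul_inv_smul₀ hε]

/-- The only danger to the contraction is the off-diagonal block ε L. For small ε it is paid for by
the additional identity in the lower diagonal block, so the rate c is unchanged. -/
theorem exists_prolong (h : WeakSaddle α β) :
    ∃ ε > 0, WeakSaddle (prolongFst α) (prolongSnd ε α β) := by
  obtain ⟨c, hc, hcon⟩ := h.contracting
  set L : E →L[ℝ] E := (fderiv ℝ β 0).comp (.inr ℝ ℝ E) with hL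
  have hLz : ∀ z, fderiv ℝ β 0 (0, z) = L z := fun z => rfl
  obtain ⟨ε, hε, hεL⟩ : ∃ ε > 0, ε * ‖L‖ ≤ 1 := by
    refine ⟨(‖L‖ + 1)⁻¹, by positivity, ?_⟩
    rw [inv_mul_le_iff₀ (by positivity)]
    linarith
  have hfst : ContDiff ℝ ∞ (fun p : ℝ × E × E => (p.1, p.2.1)) := by fun_prop
  have hq : ContDiff ℝ ∞ (fun p : ℝ × E × E => ε⁻¹ • p.2.2) := by fun_prop
  have hD : ∀ p : ℝ × E × E, ContDiffAt ℝ ∞ α (p.1, p.2.1) → ContDiffAt ℝ ∞ (fun p : ℝ × E × E =>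
      1 + p.1 * α (p.1, p.2.1) + p.1 * eulerDeriv α (p.1, p.2.1) (ε⁻¹ • p.2.2)) p := fun p hp =>
    (contDiffAt_const.add (contDiffAt_fst.mul (hp.comp p hfst.contDiffAt))).add
      (contDiffAt_fst.mul (contDiffAt_eulerDeriv hp hfst.contDiffAt hq.contDiffAt))
  have hD0 : ∀ᶠ p : ℝ × E × E in 𝓝 0,
      1 + p.1 * α (p.1, p.2.1) + p.1 * eulerDeriv α (p.1, p.2.1) (ε⁻¹ • p.2.2) ≠ 0 :=
    (hD 0 h.smooth_fst.self_of_nhds).continuousAt.eventually_ne (by simp)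
  have hsmooth : ∀ᶠ p in 𝓝 0, ContDiffAt ℝ ∞ (prolongSnd ε α β) p := by
    filter_upwards [eventually_prolong_arg h.smooth_fst, eventually_prolong_arg h.smooth_snd, hD0]
      with p hα hβ h0
    have eα := contDiffAt_eulerDeriv (b := fun p : ℝ × E × E => (p.1, p.2.1))
      (q := fun p : ℝ × E × E => ε⁻¹ • p.2.2) hα (hfst.contDiffAt (x := p)) hq.contDiffAt
    have eβ := contDiffAt_eulerDeriv (b := fun p : ℝ × E × E => (p.1, p.2.1))
      (q := fun p : ℝ × E × E => ε⁻¹ • p.2.2) hβ (hfst.contDiffAt (x := p)) hq.contDiffAt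
    have hu : ContDiffAt ℝ ∞ (fun p : ℝ × E × E => 1 + p.1 * α (p.1, p.2.1)) p :=
      contDiffAt_const.add (contDiffAt_fst.mul (hα.comp p hfst.contDiffAt))
    exact (hβ.comp p hfst.contDiffAt).prodMk (((hD p hα).inv h0).smul
      (contDiffAt_const.smul ((hu.smul eβ).add (eα.smul hq.contDiffAt))))
  refine ⟨ε, hε, ?_, hsmooth, h.fst_zero, ?_, c, hc, ?_⟩
  · filter_upwards [eventually_prolong_arg h.smooth_fst] with p hp
    exact hp.comp p hfst.contDiffAt
  · simp [prolongSnd, eulerDeriv, ← Prod.zero_eq_mk, h.snd_zero]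
  · obtain ⟨t₀, ht₀, hcon⟩ := mem_nhdsGT_iff_exists_Ioo_subset.1 hcon
    have ht₀ : 0 < t₀ := ht₀
    have hpos : 0 < min (min (1 / 2) (t₀ / 2)) (1 / (2 * c)) := by positivity
    filter_upwards [Ioo_mem_nhdsGT hpos] with t ht z
    obtain ⟨ht, ht'⟩ := ht
    obtain ⟨z, p⟩ := z
    simp only [lt_min_iff] at ht'
    obtain ⟨⟨ht1, ht2⟩, ht3⟩ := ht'
    rw [fderiv_prolongSnd_zero h hε.ne'
      (hsmooth.self_of_nhds.differentiableAt (by simp))]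
    simp only [hLz, Prod.smul_mk, Prod.mk_sub_mk]
    have hct : c * t < 1 / 2 := by
      rw [lt_div_iff₀ (by positivity)] at ht3; linarith
    have hz : ‖z‖ ≤ ‖(z, p)‖ := norm_fst_le (z, p)
    have hp : ‖p‖ ≤ ‖(z, p)‖ := norm_snd_le (z, p)
    rw [Prod.norm_def (z - _, _)]
    refine max_le ?_ ?_
    · refine (hcon ⟨ht, by linarith⟩ z).trans ?_
      gcongr
      linarith
    · have hs : 0 < 1 - t := by linarith
      have h1 : ‖p - (t / (1 - t)) • L p‖ ≤ (1 - c * (t / (1 - t))) * ‖p‖ := by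
        refine hcon ⟨by positivity, ?_⟩ p
        show t / (1 - t) < t₀
        rw [div_lt_iff₀ hs]
        nlinarith
      -- Splitting off the factor 1 - t lets the old contraction act with parameter t/(1 - t); the
      -- gained -t then offsets the coupling term t ε L z.
      have h2 : p - t • (ε • L z + L p + p) = (1 - t) • (p - (t / (1 - t)) • L p)
          - t • ε • L z := by
        rw [smul_sub, smul_smul, mul_div_cancel₀ _ hs.ne']
        module
      have h3 : ‖ε • L z‖ ≤ ‖z‖ := by
        rw [norm_smul, Real.norm_eq_abs, abs_of_pos hε]
        calc ε * ‖L z‖ ≤ ε * (‖L‖ * ‖z‖) := by gcongr; exact L.le_opNorm z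
          _ ≤ 1 * ‖z‖ := by rw [← mul_assoc]; gcongr
          _ = ‖z‖ := one_mul _
      rw [h2]
      refine (norm_sub_le _ _).trans ?_
      rw [norm_smul, norm_smul t, Real.norm_eq_abs, Real.norm_eq_abs, abs_of_pos hs, abs_of_pos ht]
      have h4 : (1 - t) * ((1 - c * (t / (1 - t))) * ‖p‖) = (1 - t - c * t) * ‖p‖ := by
        field_simp
      calc (1 - t) * ‖p - (t / (1 - t)) • L p‖ + t * ‖ε • L z‖
          ≤ (1 - t - c * t) * ‖p‖ + t * ‖z‖ := by
            rw [← h4]; gcongr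
        _ ≤ (1 - t - c * t) * ‖(z, p)‖ + t * ‖(z, p)‖ := by
            gcongr
            nlinarith
        _ = _ := by ring

end WeakSaddle
end Class

/-- If `G ∘ g` and `g` are smooth at `x` and `g' x ≠ 0`, then `G` is smooth at `g x`. -/
theorem contDiffAt_of_comp {F : Type} [NormedAddCommGroup F] [NormedSpace ℝ F] {n : ℕ∞}
    (hn : n ≠ 0) {g : ℝ → ℝ} {k G : ℝ → F} {x : ℝ} (hg : ContDiffAt ℝ n g x) (hg' : deriv g x ≠ 0)
    (hk : ContDiffAt ℝ n k x) (heq : ∀ᶠ s in 𝓝 x, G (g s) = k s) : ContDiffAt ℝ n G (g x) := by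
  have hn' : (n : WithTop ℕ∞) ≠ 0 := by exact_mod_cast hn
  have hd := (hg.differentiableAt hn').hasDerivAt.hasFDerivAt_equiv hg'
  have hinv := hg.to_localInverse hd hn'
  have hx : hg.localInverse hd hn' (g x) = x := hg.localInverse_apply_image hd hn'
  have hr : ∀ᶠ y in 𝓝 (g x), g (hg.localInverse hd hn' y) = y :=
    (hg.hasStrictFDerivAt' hd hn').eventually_right_inverse
  have hc : Tendsto (hg.localInverse hd hn') (𝓝 (g x)) (𝓝 x) := by
    have := hinv.continuousAt.tendsto
    rwa [hx] at this
  have : ContDiffAt ℝ n (fun y => k (hg.localInverse hd hn' y)) (g x) :=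
    ContDiffAt.comp (g x) (by rwa [hx]) hinv
  refine this.congr_of_eventuallyEq ?_
  filter_upwards [hr, hc.eventually heq] with y h1 h2
  rw [← h2, h1]

/-! ### The graph transform and its iterates. -/

section Iterates

variable {E : Type} [NormedAddCommGroup E] [NormedSpace ℝ E]
variable {α : ℝ × E → ℝ} {β : ℝ × E → E}

/-- The curves obtained on `(0, δ)` by iterating the graph transform, starting from zero. -/
structure GraphIterates (α : ℝ × E → ℝ) (β : ℝ × E → E) (δ : ℝ) (z : ℕ → ℝ → E) : Prop where
  zero : z 0 = 0
  smooth : ∀ n, ∀ x ∈ Ioo 0 δ, ContDiffAt ℝ ∞ (z n) x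
  regular : ∀ n, ∀ x ∈ Ioo 0 δ, deriv (baseMap α (z n)) x ≠ 0
  surj : ∀ n, ∀ X ∈ Ioo 0 δ, ∃ x ∈ Ioo 0 X, baseMap α (z n) x = X
  step : ∀ n, ∀ x ∈ Ioo 0 δ, baseMap α (z n) x ∈ Ioo 0 δ →
    z (n + 1) (baseMap α (z n) x) = fibreMap β (z n) x

theorem GraphIterates.mono {δ δ' : ℝ} {z : ℕ → ℝ → E} (h : GraphIterates α β δ z) (hδ : δ' ≤ δ) :
    GraphIterates α β δ' z where
  zero := h.zero
  smooth n x hx := h.smooth n x ⟨hx.1, hx.2.trans_le hδ⟩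
  regular n x hx := h.regular n x ⟨hx.1, hx.2.trans_le hδ⟩
  surj n X hX := h.surj n X ⟨hX.1, hX.2.trans_le hδ⟩
  step n x hx hX := h.step n x ⟨hx.1, hx.2.trans_le hδ⟩ ⟨hX.1, hX.2.trans_le hδ⟩

/-- Each point of the next curve is the image of a point of the previous one with smaller abscissa,
so an invariant ball bounds all iterates. As r is arbitrary, this also forces the limit to vanish at
0. -/
theorem WeakSaddle.exists_iterates_bound (h : WeakSaddle α β) : ∃ ρ > 0, ∀ r, 0 < r → r < ρ →
    ∃ δ₀ > 0, ∀ δ ≤ δ₀, ∀ z, GraphIterates α β δ z → ∀ n, ∀ x ∈ Ioo 0 δ, ‖z n x‖ ≤ r := by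
  obtain ⟨ρ, hρ, hball⟩ := h.exists_invariant_ball
  refine ⟨ρ, hρ, fun r hr hrρ => ?_⟩
  obtain ⟨δ₀, hδ₀, hb⟩ := hball r hr hrρ
  refine ⟨δ₀, hδ₀, fun δ hδ z hz n => ?_⟩
  induction n with
  | zero => intro x _; simp [hz.zero, hr.le]
  | succ n ih =>
    intro X hX
    obtain ⟨x, hx, rfl⟩ := hz.surj n X hX
    have hx' : x ∈ Ioo 0 δ := ⟨hx.1, hx.2.trans hX.2⟩
    rw [hz.step n x hx' hX]
    exact hb x _ hx.1 (hx'.2.trans_le hδ) (ih x hx')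

theorem hasDerivAt_baseMap {z : ℝ → E} {z' : E} {x : ℝ} (hz : HasDerivAt z z' x)
    (hα : DifferentiableAt ℝ α (x, z x)) :
    HasDerivAt (baseMap α z) (1 + x * α (x, z x) + x * eulerDeriv α (x, z x) (x • z')) x := by
  have h1 : HasDerivAt (fun x => α (x, z x)) (fderiv ℝ α (x, z x) (1, z')) x :=
    HasFDerivAt.comp_hasDerivAt x hα.hasFDerivAt ((hasDerivAt_id x).prodMk hz)
  have h2 : ((x, x • z') : ℝ × E) = x • (1, z') := by simp
  have := (hasDerivAt_id' x).fun_add (((hasDerivAt_id' x).fun_pow 2).fun_mul h1)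
  refine this.congr_deriv ?_
  simp only [eulerDeriv, h2, map_smul, smul_eq_mul]
  push_cast
  ring

theorem hasDerivAt_fibreMap {z : ℝ → E} {z' : E} {x : ℝ} (hz : HasDerivAt z z' x)
    (hβ : DifferentiableAt ℝ β (x, z x)) :
    HasDerivAt (fibreMap β z) (-z' + eulerDeriv β (x, z x) (x • z')) x := by
  have h1 : HasDerivAt (fun x => β (x, z x)) (fderiv ℝ β (x, z x) (1, z')) x :=
    HasFDerivAt.comp_hasDerivAt x hβ.hasFDerivAt ((hasDerivAt_id x).prodMk hz)
  have h2 : ((x, x • z') : ℝ × E) = x • (1, z') := by simp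
  have := hz.fun_neg.fun_add ((hasDerivAt_id' x).fun_smul h1)
  refine this.congr_deriv ?_
  simp only [eulerDeriv, h2, map_smul]
  module

/-- The curve together with its scaled Euler derivative. -/
noncomputable def prolongCurve (ε : ℝ) (z : ℝ → E) (x : ℝ) : E × E := (z x, (ε * x) • deriv z x)

theorem baseMap_prolongCurve (ε : ℝ) (z : ℝ → E) :
    baseMap (prolongFst α) (prolongCurve ε z) = baseMap α z := rfl

/-- Differentiating w(X(x)) = Z(x) by the chain rule and multiplying by ε X gives the second
component of the prolonged system. -/
theorem prolongCurve_step {ε : ℝ} (hε : ε ≠ 0) {z w : ℝ → E} {x : ℝ}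
    (hz : DifferentiableAt ℝ z x) (hα : DifferentiableAt ℝ α (x, z x))
    (hβ : DifferentiableAt ℝ β (x, z x)) (hreg : deriv (baseMap α z) x ≠ 0)
    (hw : DifferentiableAt ℝ w (baseMap α z x))
    (heq : ∀ᶠ s in 𝓝 x, w (baseMap α z s) = fibreMap β z s) :
    prolongCurve ε w (baseMap α z x) = fibreMap (prolongSnd ε α β) (prolongCurve ε z) x := by
  have hb := hasDerivAt_baseMap hz.hasDerivAt hα
  have hf := hasDerivAt_fibreMap hz.hasDerivAt hβ
  rw [hb.deriv] at hreg
  have hc := (HasDerivAt.scomp x hw.hasDerivAt hb).unique (hf.congr_of_eventuallyEq heq)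
  have hq : ε⁻¹ • (ε * x) • deriv z x = x • deriv z x := by
    rw [smul_smul, inv_mul_cancel_left₀ hε]
  set D := 1 + x * α (x, z x) + x * eulerDeriv α (x, z x) (x • deriv z x) with hD
  have hw' : deriv w (baseMap α z x) =
      D⁻¹ • (-deriv z x + eulerDeriv β (x, z x) (x • deriv z x)) := by
    rw [← hc, inv_smul_smul₀ hreg]
  refine Prod.ext ?_ ?_
  · exact heq.self_of_nhds
  · simp only [prolongCurve, fibreMap, prolongSnd, Prod.snd_add, Prod.smul_snd, Prod.snd_neg, hq]
    rw [hw', ← hD]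
    have h1 : (ε * x) • deriv z x = D⁻¹ • D • (ε * x) • deriv z x := by
      rw [inv_smul_smul₀ hreg]
    rw [h1, ← smul_neg, smul_comm x D⁻¹, ← smul_add, smul_comm _ D⁻¹]
    congr 1
    rw [hD, baseMap]
    module

/-- Prolongation commutes with the graph transform: the base map is unchanged and the zero curve
prolongs to zero. Bounds for the prolonged iterates are thus bounds for x z_n'. -/
theorem WeakSaddle.prolong_iterates (h : WeakSaddle α β) {ε : ℝ} (hε : ε ≠ 0) : ∃ δ₀ > 0,
    ∀ δ ≤ δ₀, ∀ z, GraphIterates α β δ z →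
      GraphIterates (prolongFst α) (prolongSnd ε α β) δ (fun n => prolongCurve ε (z n)) := by
  obtain ⟨ρ, hρ, hbound⟩ := h.exists_iterates_bound
  obtain ⟨r, hr, hdiff⟩ := exists_forall_of_eventually_nhds_zero (h.smooth_fst.and h.smooth_snd)
  have hr' : 0 < min (r / 2) (ρ / 2) := by positivity
  obtain ⟨δ₀, hδ₀, hb⟩ := hbound _ hr' ((min_le_right _ _).trans_lt (by linarith))
  refine ⟨min δ₀ r, lt_min hδ₀ hr, fun δ hδ z hz => ?_⟩
  refine ⟨?_, fun n x hx => ?_, fun n x hx => ?_, fun n X hX => ?_, fun n x hx hX => ?_⟩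
  · ext x <;> simp [prolongCurve, hz.zero]
  · refine (hz.smooth n x hx).prodMk ((contDiffAt_const.mul contDiffAt_id).smul ?_)
    exact ((hz.smooth n x hx).fderiv_right (m := ∞) (by simp)).clm_apply contDiffAt_const
  · rw [baseMap_prolongCurve]; exact hz.regular n x hx
  · rw [baseMap_prolongCurve]; exact hz.surj n X hX
  · simp only [baseMap_prolongCurve] at hX ⊢
    have hzr := hb δ (hδ.trans (min_le_left _ _)) z hz n x hx
    have hd := hdiff x (z n x)
      (by rw [abs_of_pos hx.1]; exact hx.2.trans_le (hδ.trans (min_le_right _ _)))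
      ((hzr.trans (min_le_left _ _)).trans_lt (by linarith))
    have hzd := (hz.smooth n x hx).differentiableAt (by simp)
    have hαd := hd.1.differentiableAt (by simp)
    refine prolongCurve_step hε hzd hαd (hd.2.differentiableAt (by simp)) (hz.regular n x hx)
      ((hz.smooth (n + 1) _ hX).differentiableAt (by simp)) ?_
    have hcont := (hasDerivAt_baseMap hzd.hasDerivAt hαd).continuousAt
    filter_upwards [Ioo_mem_nhds hx.1 hx.2, hcont.eventually (Ioo_mem_nhds hX.1 hX.2)] with s hs hS
    exact hz.step n s hs hS

/-- The curve whose graph is the image of the graph of `z` over `(0, δ)`. -/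
noncomputable def graphTransform (α : ℝ × E → ℝ) (β : ℝ × E → E) (δ : ℝ) (z : ℝ → E) (X : ℝ) : E :=
  fibreMap β z (Function.invFunOn (baseMap α z) (Ioo 0 δ) X)

/-- The graph transform needs an invertible base map, hence a bound on x z'. The property carried
along the induction is therefore smoothness together with a bound on the prolonged curve, preserved
by the invariant ball of the prolonged system. -/
theorem WeakSaddle.exists_iterates (h : WeakSaddle α β) :
    ∃ δ > 0, ∃ z, GraphIterates α β δ z := by
  obtain ⟨ε, hε, h'⟩ := h.exists_prolong
  obtain ⟨ρ, hρ, hball⟩ := h'.exists_invariant_ball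
  have hα0 := h.smooth_fst.self_of_nhds
  have c1 : ContinuousAt (fun p : ℝ × E × E => α (p.1, p.2.1)) 0 :=
    h'.smooth_fst.self_of_nhds.continuousAt
  have c2 : ContinuousAt (fun p : ℝ × E × E => eulerDeriv α (p.1, p.2.1) (ε⁻¹ • p.2.2)) 0 :=
    (contDiffAt_eulerDeriv (b := fun p : ℝ × E × E => (p.1, p.2.1))
      (q := fun p : ℝ × E × E => ε⁻¹ • p.2.2) hα0
      (by fun_prop) (by fun_prop)).continuousAt
  have hev : ∀ᶠ p : ℝ × E × E in 𝓝 0, (ContDiffAt ℝ ∞ α (p.1, p.2.1) ∧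
      ContDiffAt ℝ ∞ β (p.1, p.2.1)) ∧ (1 / 2 < α (p.1, p.2.1) ∧ α (p.1, p.2.1) < 2) ∧
        -2 < eulerDeriv α (p.1, p.2.1) (ε⁻¹ • p.2.2) := by
    refine (eventually_prolong_arg (h.smooth_fst.and h.smooth_snd)).and
      (.and (.and ?_ ?_) ?_)
    · exact c1.eventually_const_lt (by norm_num [← Prod.zero_eq_mk, h.fst_zero])
    · exact c1.eventually_lt_const (by norm_num [← Prod.zero_eq_mk, h.fst_zero])
    · exact c2.eventually_const_lt (by norm_num [eulerDeriv, ← Prod.zero_eq_mk, h.fst_zero])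
  obtain ⟨r₁, hr₁, hev⟩ := exists_forall_of_eventually_nhds_zero hev
  have hr : 0 < min (r₁ / 2) (ρ / 2) := by positivity
  have hrr₁ : min (r₁ / 2) (ρ / 2) < r₁ := (min_le_left _ _).trans_lt (by linarith)
  obtain ⟨δ₁, hδ₁, hball⟩ := hball _ hr ((min_le_right _ _).trans_lt (by linarith))
  set r := min (r₁ / 2) (ρ / 2) with hr_def
  set δ := min δ₁ (min r₁ (1 / 8)) with hδ_def
  have hδ : 0 < δ := by positivity
  have hδδ₁ : δ ≤ δ₁ := min_le_left _ _
  have hδr₁ : δ ≤ r₁ := (min_le_right _ _).trans (min_le_left _ _)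
  have hδ8 : δ ≤ 1 / 8 := (min_le_right _ _).trans (min_le_right _ _)
  let P : (ℝ → E) → Prop := fun z => ∀ x ∈ Ioo 0 δ, ContDiffAt ℝ ∞ z x ∧ ‖prolongCurve ε z x‖ ≤ r
  have hloc : ∀ z, P z → ∀ x ∈ Ioo 0 δ, (ContDiffAt ℝ ∞ α (x, z x) ∧ ContDiffAt ℝ ∞ β (x, z x)) ∧
      (1 / 2 < α (x, z x) ∧ α (x, z x) < 2) ∧ -2 < eulerDeriv α (x, z x) (x • deriv z x) := by
    intro z hz x hx
    have := hev x (prolongCurve ε z x) (by rw [abs_of_pos hx.1]; exact hx.2.trans_le hδr₁)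
      ((hz x hx).2.trans_lt hrr₁)
    simpa only [prolongCurve, smul_smul, inv_mul_cancel_left₀ hε.ne'] using this
  have hder : ∀ z, P z → ∀ x ∈ Ioo 0 δ, DifferentiableAt ℝ (baseMap α z) x ∧
      0 < deriv (baseMap α z) x := by
    intro z hz x hx
    obtain ⟨⟨hα, -⟩, ⟨ha1, ha2⟩, ha3⟩ := hloc z hz x hx
    have hd := hasDerivAt_baseMap ((hz x hx).1.differentiableAt (by simp)).hasDerivAt
      (hα.differentiableAt (by simp))
    refine ⟨hd.differentiableAt, ?_⟩
    rw [hd.deriv]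
    -- The derivative is 1 + xα + x e with α > 0, e > -2 and x < 1/8.
    nlinarith [hx.1, hx.2, mul_pos hx.1 (by linarith : 0 < α (x, z x)),
      mul_pos hx.1 (by linarith : 0 < eulerDeriv α (x, z x) (x • deriv z x) + 2)]
  have hinj : ∀ z, P z → InjOn (baseMap α z) (Ioo 0 δ) := by
    intro z hz
    refine (strictMonoOn_of_deriv_pos (convex_Ioo 0 δ)
      (fun x hx => (hder z hz x hx).1.continuousAt.continuousWithinAt) fun x hx => ?_).injOn
    rw [interior_Ioo] at hx
    exact (hder z hz x hx).2
  have hsurj : ∀ z, P z → ∀ X ∈ Ioo 0 δ, ∃ x ∈ Ioo 0 X, baseMap α z x = X := by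
    intro z hz X hX
    have hsub : Icc (X / 2) X ⊆ Ioo 0 δ := fun x hx =>
      ⟨by linarith [hX.1, hx.1], hx.2.trans_lt hX.2⟩
    have h1 : baseMap α z (X / 2) ≤ X := by
      have := (hloc z hz (X / 2) (hsub ⟨le_rfl, by linarith [hX.1]⟩)).2.1.2
      rw [baseMap]
      nlinarith [hX.1, hX.2, mul_pos hX.1 hX.1]
    have h2 : X < baseMap α z X := by
      have := (hloc z hz X hX).2.1.1
      rw [baseMap]
      nlinarith [hX.1, mul_pos hX.1 hX.1]
    obtain ⟨x, hx, hxX⟩ := intermediate_value_Icc (by linarith [hX.1])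
      (fun x hx => (hder z hz x (hsub hx)).1.continuousAt.continuousWithinAt) ⟨h1, h2.le⟩
    refine ⟨x, ⟨(hsub hx).1, lt_of_le_of_ne hx.2 ?_⟩, hxX⟩
    rintro rfl
    exact h2.ne' hxX
  have hstep : ∀ z, P z → ∀ x ∈ Ioo 0 δ,
      graphTransform α β δ z (baseMap α z x) = fibreMap β z x := by
    intro z hz x hx
    rw [graphTransform, (hinj z hz).leftInvOn_invFunOn hx]
  have hnext : ∀ z, P z → P (graphTransform α β δ z) := by
    intro z hz X hX
    obtain ⟨x, hx, rfl⟩ := hsurj z hz X hX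
    have hx' : x ∈ Ioo 0 δ := ⟨hx.1, hx.2.trans hX.2⟩
    obtain ⟨⟨hα, hβ⟩, -⟩ := hloc z hz x hx'
    have hzs := (hz x hx').1
    have heq : ∀ᶠ s in 𝓝 x, graphTransform α β δ z (baseMap α z s) = fibreMap β z s := by
      filter_upwards [Ioo_mem_nhds hx'.1 hx'.2] with s hs using hstep z hz s hs
    have hpair : ContDiffAt ℝ ∞ (fun s => (s, z s)) x := contDiffAt_id.prodMk hzs
    have hbs : ContDiffAt ℝ ∞ (baseMap α z) x :=
      contDiffAt_id.add ((contDiffAt_id.pow 2).mul (hα.comp x hpair))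
    have hfs : ContDiffAt ℝ ∞ (fibreMap β z) x :=
      hzs.neg.add (contDiffAt_id.smul (hβ.comp x hpair))
    have hsm : ContDiffAt ℝ ∞ (graphTransform α β δ z) (baseMap α z x) :=
      contDiffAt_of_comp (n := ⊤) (by simp) hbs (hder z hz x hx').2.ne' hfs heq
    refine ⟨hsm, ?_⟩
    rw [prolongCurve_step hε.ne' (hzs.differentiableAt (by simp)) (hα.differentiableAt (by simp))
      (hβ.differentiableAt (by simp)) (hder z hz x hx').2.ne' (hsm.differentiableAt (by simp)) heq]
    exact hball x _ hx'.1 (hx'.2.trans_le hδδ₁) (hz x hx').2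
  have hall : ∀ n, P ((graphTransform α β δ)^[n] 0) := by
    intro n
    induction n with
    | zero =>
      intro x _
      have : prolongCurve ε (0 : ℝ → E) x = 0 := by ext <;> simp [prolongCurve]
      exact ⟨contDiffAt_const, by rw [Function.iterate_zero, id, this, norm_zero]; exact hr.le⟩
    | succ n ih =>
      rw [Function.iterate_succ_apply']
      exact hnext _ ih
  refine ⟨δ, hδ, fun n => (graphTransform α β δ)^[n] 0, rfl, fun n x hx => (hall n x hx).1,
    fun n x hx => (hder _ (hall n) x hx).2.ne', fun n => hsurj _ (hall n), fun n x hx _ => ?_⟩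
  simp only [Function.iterate_succ_apply']
  exact hstep _ (hall n) x hx

end Iterates

/-! ### Uniform convergence of the iterates to an invariant curve. -/

section Convergence

variable {E : Type} [NormedAddCommGroup E] [NormedSpace ℝ E]
variable {α : ℝ × E → ℝ} {β : ℝ × E → E}

/-- The bound x/(1 + nx/4) is 1/(1/x + n/4): it estimates the abscissa reached after n backward
steps. The initial difference is quadratic in the abscissa, and passing forward does not increase
differences. -/
theorem WeakSaddle.exists_iterates_dist (h : WeakSaddle α β) {δ : ℝ} (hδ : 0 < δ)
    {z : ℕ → ℝ → E} (hz : GraphIterates α β δ z) : ∃ δ₁ > 0, δ₁ ≤ δ ∧ δ₁ ≤ 1 ∧ ∃ C ≥ 0, ∀ n : ℕ,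
      ∀ x ∈ Ioo 0 δ₁, ‖z (n + 1) x - z n x‖ ≤ C * (x / (1 + n * x / 4)) ^ 2 := by
  obtain ⟨c, hc, ρ, hρ, hcon⟩ := h.exists_contraction
  obtain ⟨K, t, ht, hK⟩ := (h.smooth_fst.self_of_nhds.of_le (by simp :
    ((1 : ℕ∞) : WithTop ℕ∞) ≤ ∞)).exists_lipschitzOnWith
  obtain ⟨K', t', ht', hK'⟩ := (h.smooth_snd.self_of_nhds.of_le (by simp :
    ((1 : ℕ∞) : WithTop ℕ∞) ≤ ∞)).exists_lipschitzOnWith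
  have hα : ∀ᶠ p in 𝓝 0, 1 / 2 < α p ∧ α p < 2 :=
    (h.smooth_fst.self_of_nhds.continuousAt.eventually_const_lt
      (by norm_num [h.fst_zero])).and (h.smooth_fst.self_of_nhds.continuousAt.eventually_lt_const
      (by norm_num [h.fst_zero]))
  obtain ⟨ρ₁, hρ₁, hloc⟩ := exists_forall_of_eventually_nhds_zero
    ((eventually_mem_set.2 ht).and ((eventually_mem_set.2 ht').and hα))
  obtain ⟨ε, hε, h'⟩ := h.exists_prolong
  obtain ⟨δ₂, hδ₂, hpro⟩ := h.prolong_iterates hε.ne'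
  obtain ⟨ρ', hρ', hbound⟩ := h'.exists_iterates_bound
  -- The last inequality makes the error from comparing the curve at two abscissae at most c x d,
  -- exactly what the fibre contraction gains.
  obtain ⟨r, hr, hrρ', hrρ, hrρ₁, hrc⟩ : ∃ r > 0, r < ρ' ∧ r < ρ ∧ r < ρ₁ ∧ r * K ≤ c * ε := by
    have : 0 < min (min ρ' ρ) (min ρ₁ (c * ε / (K + 1))) := by positivity
    refine ⟨min (min ρ' ρ) (min ρ₁ (c * ε / (K + 1))) / 2, by positivity, ?_, ?_, ?_, ?_⟩
    · linarith [(min_le_left (min ρ' ρ) (min ρ₁ (c * ε / (K + 1)))).trans (min_le_left _ _)]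
    · linarith [(min_le_left (min ρ' ρ) (min ρ₁ (c * ε / (K + 1)))).trans (min_le_right _ _)]
    · linarith [(min_le_right (min ρ' ρ) (min ρ₁ (c * ε / (K + 1)))).trans (min_le_left _ _)]
    · have h1 := (min_le_right (min ρ' ρ) (min ρ₁ (c * ε / (K + 1)))).trans (min_le_right _ _)
      rw [le_div_iff₀ (by positivity)] at h1
      nlinarith [K.2, show (0:ℝ) ≤ K from K.2]
  obtain ⟨δ₃, hδ₃, hb⟩ := hbound r hr hrρ'
  set η := min (min (min δ δ₂) (min δ₃ ρ)) (min ρ₁ 1) with hη_def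
  have hη : 0 < η := by positivity
  have hηδ : η ≤ δ := ((min_le_left _ _).trans (min_le_left _ _)).trans (min_le_left _ _)
  have hηδ₂ : η ≤ δ₂ := ((min_le_left _ _).trans (min_le_left _ _)).trans (min_le_right _ _)
  have hηδ₃ : η ≤ δ₃ := ((min_le_left _ _).trans (min_le_right _ _)).trans (min_le_left _ _)
  have hηρ : η ≤ ρ := ((min_le_left _ _).trans (min_le_right _ _)).trans (min_le_right _ _)
  have hηρ₁ : η ≤ ρ₁ := (min_le_right _ _).trans (min_le_left _ _)
  have hη1 : η ≤ 1 := (min_le_right _ _).trans (min_le_right _ _)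
  clear_value η
  have hzη := hz.mono hηδ
  have hcurve := hb η hηδ₃ _ (hpro η hηδ₂ z hzη)
  have hzr : ∀ n, ∀ x ∈ Ioo 0 η, ‖z n x‖ ≤ r := fun n x hx =>
    (norm_fst_le (prolongCurve ε (z n) x)).trans (hcurve n x hx)
  have hzd : ∀ n, ∀ x ∈ Ioo 0 η, ‖deriv (z n) x‖ ≤ r / (ε * x) := fun n x hx => by
    have := (norm_snd_le (prolongCurve ε (z n) x)).trans (hcurve n x hx)
    have hεx : 0 < ε * x := mul_pos hε hx.1
    rw [prolongCurve, norm_smul, Real.norm_eq_abs, abs_of_pos hεx] at this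
    rw [le_div_iff₀ hεx]
    linarith
  have hl : ∀ n, ∀ x ∈ Ioo 0 η, (x, z n x) ∈ t ∧ (x, z n x) ∈ t' ∧
      1 / 2 < α (x, z n x) ∧ α (x, z n x) < 2 := fun n x hx =>
    hloc x _ (by rw [abs_of_pos hx.1]; exact hx.2.trans_le hηρ₁) ((hzr n x hx).trans_lt hrρ₁)
  refine ⟨η / 2, by positivity, by linarith, by linarith, K', K'.2, fun n => ?_⟩
  induction n with
  | zero =>
    intro X hX
    have hXη : X ∈ Ioo 0 η := ⟨hX.1, by linarith [hX.2]⟩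
    obtain ⟨x, hx, hxX⟩ := hzη.surj 0 X hXη
    have hx' : x ∈ Ioo 0 η := ⟨hx.1, hx.2.trans hXη.2⟩
    have e1 : z 1 X = x • β (x, 0) := by
      rw [← hxX, hzη.step 0 x hx' (by rw [hxX]; exact hXη)]
      simp [fibreMap, hz.zero]
    have e2 : ‖β (x, 0)‖ ≤ K' * x := by
      have := hK'.norm_sub_le (x := (x, 0)) (by simpa [hz.zero] using (hl 0 x hx').2.1)
        (mem_of_mem_nhds ht')
      simpa [h.snd_zero, Prod.norm_def, abs_of_pos hx.1, hx.1.le] using this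
    rw [zero_add, e1, hz.zero, Pi.zero_apply, sub_zero, norm_smul, Real.norm_eq_abs,
      abs_of_pos hx.1]
    simp only [Nat.cast_zero, zero_mul, zero_div, add_zero, div_one]
    calc x * ‖β (x, 0)‖ ≤ x * (K' * x) := by gcongr; exact hx.1.le
      _ = K' * x ^ 2 := by ring
      _ ≤ K' * X ^ 2 := by gcongr; exacts [hx.1.le, hx.2.le]
  | succ n ih =>
    intro X hX
    have hXη : X ∈ Ioo 0 η := ⟨hX.1, by linarith [hX.2]⟩
    obtain ⟨x, hx, hxX⟩ := hzη.surj (n + 1) X hXη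
    have hx0 := hx.1
    have hx2 : x ∈ Ioo 0 (η / 2) := ⟨hx.1, hx.2.trans hX.2⟩
    have hx' : x ∈ Ioo 0 η := ⟨hx.1, hx.2.trans hXη.2⟩
    obtain ⟨l1, -, l2, l3⟩ := hl n x hx'
    obtain ⟨m1, -, m2, m3⟩ := hl (n + 1) x hx'
    set d := ‖z (n + 1) x - z n x‖ with hd
    set X' := baseMap α (z n) x with hX'_def
    have hX' : X' ∈ Ico x η := by
      rw [hX'_def, baseMap]
      constructor
      · nlinarith [mul_pos hx0 hx0]
      · nlinarith [mul_pos hx0 hx0, hx2.2]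
    have hdist : ‖X - X'‖ ≤ x ^ 2 * (K * d) := by
      rw [← hxX, hX'_def, baseMap, baseMap, add_sub_add_left_eq_sub, ← mul_sub, norm_mul,
        norm_pow, Real.norm_eq_abs x, abs_of_pos hx0]
      gcongr
      refine (hK.norm_sub_le m1 l1).trans_eq ?_
      simp [Prod.norm_def, hd]
    -- Both abscissae are at least x, where the prolonged bound gives slope at most r/(εx).
    have hlip : ‖z (n + 1) X - z (n + 1) X'‖ ≤ r / (ε * x) * ‖X - X'‖ := by
      have hsub : ∀ s ∈ Ico x η, s ∈ Ioo 0 η := fun s hs => ⟨hx0.trans_le hs.1, hs.2⟩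
      refine (convex_Ico x η).norm_image_sub_le_of_norm_deriv_le (𝕜 := ℝ)
        (fun s hs => (hzη.smooth (n + 1) s (hsub s hs)).differentiableAt (by simp))
        (fun s hs => ?_) hX' ⟨hx.2.le, hXη.2⟩
      refine (hzd (n + 1) s (hsub s hs)).trans ?_
      have := hs.1
      gcongr
    have e1 : z (n + 1 + 1) X = fibreMap β (z (n + 1)) x := by
      rw [← hxX, hzη.step (n + 1) x hx' (by rw [hxX]; exact hXη)]
    have e2 : z (n + 1) X' = fibreMap β (z n) x :=
      hzη.step n x hx' ⟨hx0.trans_le hX'.1, hX'.2⟩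
    have e3 := hcon x (z (n + 1) x) (z n x) hx0 (hx'.2.trans_le hηρ)
      ((hzr _ x hx').trans_lt hrρ) ((hzr _ x hx').trans_lt hrρ)
    have e4 : ‖z (n + 1) X - z (n + 1) X'‖ ≤ c * x * d := by
      refine hlip.trans ((mul_le_mul_of_nonneg_left hdist (by positivity)).trans ?_)
      rw [div_mul_eq_mul_div, div_le_iff₀ (by positivity)]
      have : 0 ≤ x ^ 2 * d := by positivity
      nlinarith [mul_le_mul_of_nonneg_left hrc this]
    have e5 : ‖z (n + 1 + 1) X - z (n + 1) X‖ ≤ d := by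
      have : z (n + 1 + 1) X - z (n + 1) X = (fibreMap β (z (n + 1)) x - fibreMap β (z n) x)
          - (z (n + 1) X - z (n + 1) X') := by rw [e1, ← e2]; abel
      rw [this]
      refine (norm_sub_le _ _).trans ((add_le_add e3 e4).trans_eq ?_)
      ring
    refine e5.trans ((ih x hx2).trans ?_)
    -- This amounts to 1/x ≥ 1/X + 1/4, which advances n by one in the bound.
    have hXx : x + x ^ 2 / 2 ≤ X := by
      rw [← hxX, baseMap]
      nlinarith [mul_pos hx0 hx0]
    have hx1 : x < 1 := by linarith [hx'.2]
    have hX0 := hX.1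
    refine mul_le_mul_of_nonneg_left (pow_le_pow_left₀ (by positivity) ?_ 2) K'.2
    rw [div_le_div_iff₀ (by positivity) (by positivity)]
    push_cast
    have e6 : 0 ≤ x ^ 2 * (1 / 4 - x / 8) := mul_nonneg (sq_nonneg x) (by linarith)
    have e7 := mul_le_mul_of_nonneg_right hXx (by linarith : 0 ≤ 1 - x / 4)
    linarith

theorem WeakSaddle.exists_limit [CompleteSpace E] (h : WeakSaddle α β) {δ : ℝ} (hδ : 0 < δ)
    {z : ℕ → ℝ → E} (hz : GraphIterates α β δ z) : ∃ δ₁ > 0, δ₁ ≤ δ ∧ ∃ ζ : ℝ → E,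
      TendstoUniformlyOn z ζ atTop (Ioo 0 δ₁) ∧ Tendsto ζ (𝓝[>] 0) (𝓝 0) ∧
        ContinuousOn ζ (Ioo 0 δ₁) := by
  obtain ⟨δ₁, hδ₁, hδ₁δ, hδ₁1, C, hC, hdist⟩ := h.exists_iterates_dist hδ hz
  have hsum : Summable fun n : ℕ => C * (4 / ((n : ℝ) + 1)) ^ 2 := by
    have := (summable_nat_add_iff 1).2 (Real.summable_one_div_nat_pow.2 one_lt_two)
    refine (this.mul_left (C * 16)).congr fun n => ?_
    push_cast
    rw [div_pow]
    ring
  have hunif := tendstoUniformlyOn_tsum_nat (f := fun n x => z (n + 1) x - z n x) (s := Ioo 0 δ₁)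
    hsum (fun n x hx => by
      refine (hdist n x hx).trans ?_
      have := hx.1
      refine mul_le_mul_of_nonneg_left (pow_le_pow_left₀ (by positivity) ?_ 2) hC
      rw [div_le_div_iff₀ (by positivity) (by positivity)]
      nlinarith [hx.2])
  have hz' : (fun N x => ∑ n ∈ Finset.range N, (z (n + 1) x - z n x)) = z := by
    funext N x
    rw [Finset.sum_range_sub fun n => z n x, hz.zero, Pi.zero_apply, sub_zero]
  rw [hz'] at hunif
  refine ⟨δ₁, hδ₁, hδ₁δ, _, hunif, ?_, ?_⟩
  · rw [Metric.tendsto_nhds]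
    intro e he
    obtain ⟨ρ, hρ, hbound⟩ := h.exists_iterates_bound
    have hr : 0 < min (e / 2) (ρ / 2) := by positivity
    obtain ⟨δ₀, hδ₀, hb⟩ := hbound _ hr ((min_le_right _ _).trans_lt (by linarith))
    filter_upwards [Ioo_mem_nhdsGT (lt_min hδ₀ hδ₁)] with x hx
    have hx0 : x ∈ Ioo 0 (min δ₀ δ₁) := hx
    have := le_of_tendsto (hunif.tendsto_at ⟨hx.1, hx.2.trans_le (min_le_right _ _)⟩).norm
      (.of_forall fun n => hb _ (min_le_left _ _) z
        (hz.mono ((min_le_right _ _).trans hδ₁δ)) n x hx)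
    rw [dist_zero_right]
    exact this.trans_lt ((min_le_left _ _).trans_lt (by linarith))
  · exact hunif.continuousOn (.of_forall fun n x hx =>
      (hz.smooth n x ⟨hx.1, hx.2.trans_le hδ₁δ⟩).continuousAt.continuousWithinAt)

/-- Abscissa and curve both vary with n in z_{n+1}(X_n); uniform convergence and continuity of ζ
allow passing to the limit. -/
theorem WeakSaddle.limit_invariant (h : WeakSaddle α β) {δ δ₁ : ℝ} (hδ₁ : 0 < δ₁) (hδ : δ₁ ≤ δ)
    {z : ℕ → ℝ → E} (hz : GraphIterates α β δ z) {ζ : ℝ → E}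
    (hunif : TendstoUniformlyOn z ζ atTop (Ioo 0 δ₁)) (hζ : Tendsto ζ (𝓝[>] 0) (𝓝 0))
    (hcont : ContinuousOn ζ (Ioo 0 δ₁)) :
    ∀ᶠ x in 𝓝[>] 0, ζ (baseMap α ζ x) = fibreMap β ζ x := by
  have hα : ∀ᶠ p in 𝓝 0, 1 / 2 < α p ∧ α p < 2 :=
    (h.smooth_fst.self_of_nhds.continuousAt.eventually_const_lt
      (by norm_num [h.fst_zero])).and (h.smooth_fst.self_of_nhds.continuousAt.eventually_lt_const
      (by norm_num [h.fst_zero]))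
  have hpair : Tendsto (fun x => (x, ζ x)) (𝓝[>] 0) (𝓝 0) :=
    (tendsto_id.mono_left nhdsWithin_le_nhds).prodMk_nhds hζ
  have hpos : 0 < min (δ₁ / 2) (1 / 4) := by positivity
  filter_upwards [hpair.eventually (h.smooth_fst.and (h.smooth_snd.and hα)),
    Ioo_mem_nhdsGT hpos] with x ⟨hαx, hβx, ha1, ha2⟩ hx
  have hx0 : 0 < x := hx.1
  have hx1 := hx.2.trans_le (min_le_left _ _)
  have hx2 := hx.2.trans_le (min_le_right _ _)
  have hxδ : x ∈ Ioo 0 δ₁ := ⟨hx0, by linarith⟩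
  have hX : baseMap α ζ x ∈ Ioo 0 δ₁ := by
    rw [baseMap]
    constructor
    · nlinarith [mul_pos hx0 hx0]
    · nlinarith [mul_pos hx0 hx0]
  have hzx : Tendsto (fun n => (x, z n x)) atTop (𝓝 (x, ζ x)) :=
    tendsto_const_nhds.prodMk_nhds (hunif.tendsto_at hxδ)
  have hbase : Tendsto (fun n => baseMap α (z n) x) atTop (𝓝 (baseMap α ζ x)) :=
    tendsto_const_nhds.add (tendsto_const_nhds.mul (hαx.continuousAt.tendsto.comp hzx))
  have hfib : Tendsto (fun n => fibreMap β (z n) x) atTop (𝓝 (fibreMap β ζ x)) :=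
    (hunif.tendsto_at hxδ).neg.add (tendsto_const_nhds.smul (hβx.continuousAt.tendsto.comp hzx))
  have hev : ∀ᶠ n in atTop, baseMap α (z n) x ∈ Ioo 0 δ₁ :=
    hbase.eventually (Ioo_mem_nhds hX.1 hX.2)
  have hunif' : TendstoUniformlyOn (fun n => z (n + 1)) ζ atTop (Ioo 0 δ₁) := fun u hu =>
    (tendsto_add_atTop_nat 1).eventually (hunif u hu)
  have hlim : Tendsto (fun n => z (n + 1) (baseMap α (z n) x)) atTop (𝓝 (ζ (baseMap α ζ x))) :=
    hunif'.tendstoLocallyUniformlyOn.tendsto_comp (hcont _ hX) hX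
      (tendsto_nhdsWithin_iff.2 ⟨hbase, hev⟩)
  refine tendsto_nhds_unique hlim (hfib.congr' ?_)
  filter_upwards [hev] with n hn
  rw [hz.step n x ⟨hx0, hxδ.2.trans_le hδ⟩ ⟨hn.1, hn.2.trans_le hδ⟩]

end Convergence

/-! ### Differentiability of the limit curve. -/

section Regularity

/-- `x ^ N • ζ x` for `x > 0`, extended by zero. -/
noncomputable def flatExt {E : Type} [NormedAddCommGroup E] [NormedSpace ℝ E] (N : ℕ) (ζ : ℝ → E)
    (x : ℝ) : E := if 0 < x then x ^ N • ζ x else 0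

section

variable {E : Type} [NormedAddCommGroup E] [NormedSpace ℝ E]

theorem flatExt_of_pos {N : ℕ} {ζ : ℝ → E} {x : ℝ} (hx : 0 < x) : flatExt N ζ x = x ^ N • ζ x :=
  if_pos hx

theorem flatExt_of_nonpos {N : ℕ} {ζ : ℝ → E} {x : ℝ} (hx : x ≤ 0) : flatExt N ζ x = 0 :=
  if_neg hx.not_gt

theorem flatExt_eventuallyEq {N : ℕ} {ζ : ℝ → E} {x : ℝ} (hx : 0 < x) :
    flatExt N ζ =ᶠ[𝓝 x] fun x => x ^ N • ζ x := by
  filter_upwards [Ioi_mem_nhds hx] with y hy using flatExt_of_pos hy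

theorem flatExt_isLittleO {N : ℕ} {ζ : ℝ → E} (hζ : Tendsto ζ (𝓝[>] 0) (𝓝 0)) :
    flatExt N ζ =o[𝓝 0] fun x => x ^ N := by
  rw [isLittleO_iff]
  intro c hc
  have h := (mem_nhdsWithin_iff_eventually.1 ((tendsto_zero_iff_norm_tendsto_zero.1 hζ).eventually
    (eventually_le_nhds hc)))
  filter_upwards [h] with x hx
  rcases le_or_gt x 0 with h0 | h0
  · rw [flatExt_of_nonpos h0, norm_zero]; positivity
  · rw [flatExt_of_pos h0, norm_smul, mul_comm]
    gcongr
    exact hx h0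

theorem continuousOn_flatExt {N : ℕ} {δ : ℝ} {ζ : ℝ → E} (hN : N ≠ 0)
    (hζ : Tendsto ζ (𝓝[>] 0) (𝓝 0)) (hc : ContinuousOn ζ (Ioo 0 δ)) :
    ContinuousOn (flatExt N ζ) (Iio δ) := by
  intro x hx
  refine ContinuousAt.continuousWithinAt ?_
  rcases lt_trichotomy x 0 with h0 | rfl | h0
  · refine continuousAt_const.congr (f := fun _ => (0 : E)) ?_
    filter_upwards [Iio_mem_nhds h0] with y hy using (flatExt_of_nonpos (le_of_lt hy)).symm
  · rw [ContinuousAt, flatExt_of_nonpos le_rfl]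
    refine (flatExt_isLittleO hζ).trans_tendsto ?_
    simpa [hN] using (continuous_pow N).tendsto (0 : ℝ)
  · exact ((continuousAt_id.pow N).smul (hc.continuousAt (Ioo_mem_nhds h0 hx))).congr
      (flatExt_eventuallyEq h0).symm

/-- With q = x ζ', the derivative of x^(N+1) ζ is x^N ((N+1) ζ + q): one derivative costs one power
of x and involves only functions that tend to zero or are prolonged components. -/
theorem hasDerivAt_flatExt {N : ℕ} {δ : ℝ} {ζ q : ℝ → E}
    (hζ : Tendsto ζ (𝓝[>] 0) (𝓝 0)) (hd : ∀ x ∈ Ioo 0 δ, HasDerivAt ζ (x⁻¹ • q x) x) {x : ℝ}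
    (hx : x < δ) :
    HasDerivAt (flatExt (N + 1) ζ) (flatExt N (fun x => ((N : ℝ) + 1) • ζ x + q x) x) x := by
  rcases lt_trichotomy x 0 with h0 | rfl | h0
  · rw [flatExt_of_nonpos h0.le]
    refine (hasDerivAt_const x (0 : E)).congr_of_eventuallyEq ?_
    filter_upwards [Iio_mem_nhds h0] with y hy using flatExt_of_nonpos (le_of_lt hy)
  · rw [flatExt_of_nonpos le_rfl, hasDerivAt_iff_isLittleO_nhds_zero]
    simp only [zero_add, flatExt_of_nonpos le_rfl, sub_zero, smul_zero]
    refine (flatExt_isLittleO hζ).trans_isBigO ?_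
    simpa [pow_succ] using ((((continuous_pow N).tendsto (0 : ℝ)).isBigO_one ℝ).mul
      (isBigO_refl (fun x : ℝ => x) (𝓝 0)))
  · rw [flatExt_of_pos h0]
    refine HasDerivAt.congr_of_eventuallyEq ?_ (flatExt_eventuallyEq h0)
    refine (((hasDerivAt_id' x).fun_pow (N + 1)).fun_smul (hd x ⟨h0, hx⟩)).congr_deriv ?_
    rw [pow_succ, mul_smul, smul_inv_smul₀ h0.ne']
    push_cast
    module

end

/-- E is quantified inside the induction because the step uses E × E. The iterates are given data,
so that the first component of the prolonged limit is the limit of the original iterates and the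
second is its scaled Euler derivative. -/
theorem WeakSaddle.limit_regular (k : ℕ) : ∀ {E : Type} [NormedAddCommGroup E] [NormedSpace ℝ E]
    [CompleteSpace E] {α : ℝ × E → ℝ} {β : ℝ × E → E}, WeakSaddle α β → ∀ {δ : ℝ}, 0 < δ →
    ∀ {z : ℕ → ℝ → E}, GraphIterates α β δ z → ∃ δ₁ > 0, δ₁ ≤ δ ∧ ∃ ζ : ℝ → E,
      TendstoUniformlyOn z ζ atTop (Ioo 0 δ₁) ∧ Tendsto ζ (𝓝[>] 0) (𝓝 0) ∧
        ContinuousOn ζ (Ioo 0 δ₁) ∧ ∀ N > k, ContDiffOn ℝ k (flatExt N ζ) (Iio δ₁) := by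
  induction k with
  | zero =>
    intro E _ _ _ α β h δ hδ z hz
    obtain ⟨δ₁, hδ₁, hδ₁δ, ζ, h1, h2, h3⟩ := h.exists_limit hδ hz
    exact ⟨δ₁, hδ₁, hδ₁δ, ζ, h1, h2, h3, fun N hN =>
      contDiffOn_zero.2 (continuousOn_flatExt hN.ne' h2 h3)⟩
  | succ k ih =>
    intro E _ _ _ α β h δ hδ z hz
    obtain ⟨ε, hε, h'⟩ := h.exists_prolong
    obtain ⟨δ₀, hδ₀, hpro⟩ := h.prolong_iterates hε.ne'
    obtain ⟨δ₁, hδ₁, hle, ζ, hunif, hlim, hcont, hreg⟩ :=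
      ih h' (lt_min hδ hδ₀) (hpro _ (min_le_right δ δ₀) z (hz.mono (min_le_left _ _)))
    have hδ₁δ : δ₁ ≤ δ := hle.trans (min_le_left _ _)
    have hu1 : TendstoUniformlyOn z (fun x => (ζ x).1) atTop (Ioo 0 δ₁) :=
      uniformContinuous_fst.comp_tendstoUniformlyOn hunif
    have hu2 := uniformContinuous_snd.comp_tendstoUniformlyOn hunif
    have hlim1 : Tendsto (fun x => (ζ x).1) (𝓝[>] 0) (𝓝 0) :=
      (continuous_fst.tendsto (0 : E × E)).comp hlim
    -- Away from 0, division by εs preserves uniform convergence, so the derivatives converge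
    -- uniformly on (x/2, δ₁).
    have hder : ∀ x ∈ Ioo 0 δ₁, HasDerivAt (fun x => (ζ x).1) (x⁻¹ • ε⁻¹ • (ζ x).2) x := by
      intro x hx
      have hx2 : 0 < x / 2 := half_pos hx.1
      have hsub : Ioo (x / 2) δ₁ ⊆ Ioo 0 δ₁ := Ioo_subset_Ioo_left hx2.le
      refine hasDerivAt_of_tendstoUniformlyOn (f := z) (f' := fun n => deriv (z n))
        (g' := fun x => x⁻¹ • ε⁻¹ • (ζ x).2) (l := atTop) (s := Ioo (x / 2) δ₁) isOpen_Ioo ?_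
        (.of_forall fun n s hs => ?_) (fun s hs => ?_) ⟨by linarith [hx.1], hx.2⟩
      · rw [Metric.tendstoUniformlyOn_iff]
        intro e he
        filter_upwards [Metric.tendstoUniformlyOn_iff.1 (hu2.mono hsub) (e * (x / 2 * ε))
          (by positivity)] with n hn s hs
        have h1 := hn s hs
        have hs0 : 0 < s := (hsub hs).1
        simp only [Function.comp, prolongCurve] at h1
        have h2 : deriv (z n) s = s⁻¹ • ε⁻¹ • (ε * s) • deriv (z n) s := by
          rw [mul_smul, inv_smul_smul₀ hε.ne', inv_smul_smul₀ hs0.ne']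
        rw [h2, dist_smul₀, dist_smul₀, norm_inv, norm_inv, Real.norm_eq_abs, Real.norm_eq_abs,
          abs_of_pos hε, abs_of_pos hs0, inv_mul_lt_iff₀ hs0, inv_mul_lt_iff₀ hε]
        refine h1.trans ?_
        nlinarith [hs.1, mul_pos he hε]
      · exact ((hz.smooth n s ⟨(hsub hs).1, (hsub hs).2.trans_le hδ₁δ⟩).differentiableAt
          (by simp)).hasDerivAt
      · exact hu1.tendsto_at (hsub hs)
    refine ⟨δ₁, hδ₁, hδ₁δ, fun x => (ζ x).1, hu1, hlim1, hcont.fst, fun N hN => ?_⟩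
    obtain ⟨M, rfl⟩ : ∃ M, N = M + 1 := ⟨N - 1, by omega⟩
    have hd := fun x (hx : x ∈ Iio δ₁) => hasDerivAt_flatExt (N := M) hlim1 hder hx
    push_cast
    rw [contDiffOn_succ_iff_deriv_of_isOpen isOpen_Iio]
    refine ⟨fun x hx => (hd x hx).differentiableAt.differentiableWithinAt, by simp, ?_⟩
    let T : E × E →L[ℝ] E := ((M : ℝ) + 1) • .fst ℝ E E + ε⁻¹ • .snd ℝ E E
    refine (T.contDiff.comp_contDiffOn (hreg M (by omega))).congr fun x hx => ?_
    rw [(hd x hx).deriv]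
    simp only [flatExt, Function.comp]
    split_ifs
    · rw [map_smul]; rfl
    · rw [map_zero]

/-- A weak saddle has an invariant curve which is as regular as one likes once multiplied by a power
of `x`. -/
theorem WeakSaddle.exists_invariant {E : Type} [NormedAddCommGroup E] [NormedSpace ℝ E]
    [CompleteSpace E] {α : ℝ × E → ℝ} {β : ℝ × E → E} (h : WeakSaddle α β) (k : ℕ) :
    ∃ ζ : ℝ → E, Tendsto ζ (𝓝[>] 0) (𝓝 0) ∧
      (∀ᶠ x in 𝓝[>] 0, ζ (baseMap α ζ x) = fibreMap β ζ x) ∧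
      ∃ δ > 0, ∀ N > k, ContDiffOn ℝ k (flatExt N ζ) (Iio δ) := by
  obtain ⟨δ, hδ, z, hz⟩ := h.exists_iterates
  obtain ⟨δ₁, hδ₁, hδ₁δ, ζ, hunif, hlim, hcont, hreg⟩ := h.limit_regular k hδ hz
  exact ⟨ζ, hlim, h.limit_invariant hδ₁ hδ₁δ hz hunif hlim hcont, δ₁, hδ₁, hreg⟩

end Regularity

/-! ### Division of smooth germs by powers of x. -/

section Division

/-- The integral is the value at 0 of the convolution of the indicator of [0, 1] with t ↦ χ(t) K(p,
-t), where the cutoff χ supplies compact support and equals 1 where it matters. -/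
theorem contDiff_integral_unitInterval {P : Type} [NormedAddCommGroup P] [NormedSpace ℝ P]
    {K : P × ℝ → ℝ} (hK : ContDiff ℝ ∞ K) : ContDiff ℝ ∞ fun p => ∫ t in (0 : ℝ)..1, K (p, t) := by
  let χ : ContDiffBump (0 : ℝ) := ⟨1, 2, one_pos, one_lt_two⟩
  have h := MeasureTheory.contDiffOn_convolution_right_with_param_comp (𝕜 := ℝ)
    (μ := MeasureTheory.volume) (n := ⊤) (.mul ℝ ℝ) (s := univ) (v := fun _ : P => (0 : ℝ))
    contDiffOn_const (f := indicator (Icc 0 1) 1) (g := fun p t => χ t * K (p, -t))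
    (k := Metric.closedBall 0 2) isOpen_univ (isCompact_closedBall _ _)
    (fun p x _ hx => by
      rw [χ.zero_of_le_dist, zero_mul]
      exact (not_le.1 hx).le)
    (((continuousOn_const (c := (1 : ℝ))).integrableOn_Icc.integrable_indicator
      measurableSet_Icc).locallyIntegrable)
    (by
      refine ContDiff.contDiffOn ?_
      exact (χ.contDiff.comp contDiff_snd).mul
        (hK.comp (contDiff_fst.prodMk contDiff_snd.neg)))
  rw [contDiffOn_univ] at h
  convert h using 1
  funext p
  rw [MeasureTheory.convolution_def, intervalIntegral.integral_of_le zero_le_one,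
    ← MeasureTheory.integral_Icc_eq_integral_Ioc, ← MeasureTheory.integral_indicator
      measurableSet_Icc]
  congr 1
  ext t
  by_cases ht : t ∈ Icc (0 : ℝ) 1
  · have : χ (-t) = 1 := χ.one_of_mem_closedBall (by
      simp only [Metric.mem_closedBall, dist_zero_right, norm_neg, Real.norm_eq_abs]
      exact abs_le.2 ⟨by linarith [ht.1], ht.2⟩)
    simp [ht, this]
  · simp [ht]

/-- The quotient is the integral over t in [0, 1] of ∂ₓF(tx, w), by the fundamental theorem of
calculus. -/
theorem exists_eq_mul_of_contDiff {F : ℝ × ℝ → ℝ} (hF : ContDiff ℝ ∞ F)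
    (h0 : ∀ w, F (0, w) = 0) : ∃ g : ℝ × ℝ → ℝ, ContDiff ℝ ∞ g ∧ ∀ p, F p = p.1 * g p := by
  have hF' : ContDiff ℝ ∞ (fun q : (ℝ × ℝ) × ℝ =>
      fderiv ℝ F (q.2 * q.1.1, q.1.2) ((1 : ℝ), (0 : ℝ))) := by
    have h1 : ContDiff ℝ ∞ (fderiv ℝ F) := hF.fderiv_right (by simp)
    have h2 : ContDiff ℝ ∞ fun q : (ℝ × ℝ) × ℝ => (q.2 * q.1.1, q.1.2) := by fun_prop
    exact (h1.comp h2).clm_apply contDiff_const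
  refine ⟨_, contDiff_integral_unitInterval hF', fun p => ?_⟩
  have hd : ∀ t : ℝ, HasDerivAt (fun t => F (t * p.1, p.2))
      (p.1 * fderiv ℝ F (t * p.1, p.2) ((1 : ℝ), (0 : ℝ))) t := fun t => by
    have h1 : HasDerivAt (fun t : ℝ => (t * p.1, p.2)) (p.1 • ((1 : ℝ), (0 : ℝ))) t := by
      simpa using ((hasDerivAt_id t).mul_const p.1).prodMk (hasDerivAt_const t p.2)
    have := HasFDerivAt.comp_hasDerivAt t
      (hF.differentiable (by simp)).differentiableAt.hasFDerivAt h1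
    rwa [map_smul] at this
  have hint := intervalIntegral.integral_eq_sub_of_hasDerivAt (a := 0) (b := 1)
    (fun t _ => hd t) (Continuous.intervalIntegrable (continuous_const.mul
      (hF'.continuous.comp (by fun_prop : Continuous fun t : ℝ => (p, t)))) _ _)
  rw [intervalIntegral.integral_const_mul] at hint
  simpa [h0] using hint.symm

/-- Hadamard's lemma: a germ of a smooth function on the plane which vanishes on the line `x = 0`
is divisible by `x`. -/
theorem exists_eventually_eq_mul {f : ℝ × ℝ → ℝ} (hf : ∀ᶠ p in 𝓝 0, ContDiffAt ℝ ∞ f p)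
    (h0 : ∀ᶠ w in 𝓝 (0 : ℝ), f (0, w) = 0) : ∃ g : ℝ × ℝ → ℝ,
      (∀ᶠ p in 𝓝 0, ContDiffAt ℝ ∞ g p) ∧ ∀ᶠ p in 𝓝 0, f p = p.1 * g p := by
  have h0' : ∀ᶠ p : ℝ × ℝ in 𝓝 0, f (0, p.2) = 0 :=
    (continuous_snd.tendsto' (0 : ℝ × ℝ) 0 rfl).eventually h0
  obtain ⟨ρ, hρ, h⟩ := Metric.eventually_nhds_iff_ball.1 (hf.and h0')
  let χ : ContDiffBump (0 : ℝ × ℝ) := ⟨ρ / 4, ρ / 2, by positivity, by linarith⟩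
  have hF : ContDiff ℝ ∞ fun p => χ p * f p := by
    rw [contDiff_iff_contDiffAt]
    intro p
    by_cases hp : p ∈ Metric.ball (0 : ℝ × ℝ) ρ
    · exact χ.contDiffAt.mul (h p hp).1
    · have hp' : p ∈ (Metric.closedBall (0 : ℝ × ℝ) (ρ / 2))ᶜ := fun hp2 =>
        hp (Metric.closedBall_subset_ball (by linarith) hp2)
      refine (contDiffAt_const (c := (0 : ℝ))).congr_of_eventuallyEq ?_
      filter_upwards [Metric.isClosed_closedBall.isOpen_compl.mem_nhds hp'] with q hq
      rw [χ.zero_of_le_dist, zero_mul]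
      exact (not_le.1 (Metric.mem_closedBall.not.1 hq)).le
  obtain ⟨g, hg, hfg⟩ := exists_eq_mul_of_contDiff hF fun w => by
    by_cases hw : ((0 : ℝ), w) ∈ Metric.ball (0 : ℝ × ℝ) ρ
    · rw [(h _ hw).2, mul_zero]
    · rw [χ.zero_of_le_dist, zero_mul]
      have : ρ ≤ dist ((0 : ℝ), w) 0 := not_lt.1 hw
      exact (by linarith : ρ / 2 ≤ ρ).trans this
  refine ⟨g, .of_forall fun p => hg.contDiffAt, ?_⟩
  filter_upwards [χ.eventuallyEq_one] with p hp
  rw [← hfg, hp, Pi.one_apply, one_mul]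

theorem eq_of_norm_sub_le {G : ℝ × ℝ → ℝ} {w c : ℝ} {b : ℝ → ℝ} (hG : ContinuousAt G (0, w))
    (hb : Tendsto b (𝓝 0) (𝓝 0)) (h : ∀ᶠ x in 𝓝[≠] 0, |G (x, w) - c| ≤ b x) : G (0, w) = c := by
  have h1 : Tendsto (fun x => G (x, w)) (𝓝[≠] 0) (𝓝 (G (0, w))) :=
    hG.tendsto.comp ((by fun_prop : Continuous fun x : ℝ => (x, w)).tendsto' 0 _ rfl
      |>.mono_left nhdsWithin_le_nhds)
  have h2 : Tendsto (fun x => G (x, w)) (𝓝[≠] 0) (𝓝 c) := by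
    rw [tendsto_iff_norm_sub_tendsto_zero]
    exact squeeze_zero' (.of_forall fun _ => norm_nonneg _) h (hb.mono_left nhdsWithin_le_nhds)
  exact tendsto_nhds_unique h1 h2

/-- Two divisions by x; the error bound C|x|³ makes the first quotient vanish at x = 0 and
identifies the second one there as φ. -/
theorem exists_eventually_eq_sq_mul {f : ℝ × ℝ → ℝ} {φ : ℝ → ℝ} {C : ℝ}
    (hf : ∀ᶠ p in 𝓝 0, ContDiffAt ℝ ∞ f p)
    (h : ∀ᶠ p in 𝓝 0, |f p - p.1 ^ 2 * φ p.2| ≤ C * |p.1| ^ 3) : ∃ g : ℝ × ℝ → ℝ,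
      (∀ᶠ p in 𝓝 0, ContDiffAt ℝ ∞ g p) ∧ (∀ᶠ p in 𝓝 0, f p = p.1 ^ 2 * g p) ∧
        ∀ᶠ w in 𝓝 0, g (0, w) = φ w := by
  have hpt : Tendsto (fun w : ℝ => ((0 : ℝ), w)) (𝓝 0) (𝓝 0) :=
    (by fun_prop : Continuous fun w : ℝ => ((0 : ℝ), w)).tendsto' 0 _ rfl
  have hline : ∀ {P : ℝ × ℝ → Prop}, (∀ᶠ p in 𝓝 0, P p) →
      ∀ᶠ w in 𝓝 (0 : ℝ), ∀ᶠ x in 𝓝[≠] 0, P (x, w) := by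
    intro P hP
    filter_upwards [hpt.eventually hP.eventually_nhds] with w hw
    exact ((by fun_prop : Continuous fun x : ℝ => (x, w)).tendsto' 0 _ rfl).mono_left
      nhdsWithin_le_nhds |>.eventually hw
  obtain ⟨g₁, hg₁, hfg₁⟩ := exists_eventually_eq_mul hf (by
    filter_upwards [hpt.eventually h] with w hw
    simpa using hw)
  have hne : ∀ᶠ x : ℝ in 𝓝[≠] 0, x ≠ 0 := self_mem_nhdsWithin
  obtain ⟨g, hg, hg₁g⟩ := exists_eventually_eq_mul hg₁ (by
    filter_upwards [hpt.eventually hg₁, hline hfg₁, hline h] with w h1 h2 h3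
    refine eq_of_norm_sub_le h1.continuousAt (b := fun x => |x| * |φ w| + C * |x| ^ 2)
      ((by fun_prop : Continuous fun x : ℝ => |x| * |φ w| + C * |x| ^ 2).tendsto' 0 _ (by simp)) ?_
    filter_upwards [h2, h3, hne] with x h2 h3 hx
    rw [h2] at h3
    have hx' : 0 < |x| := abs_pos.2 hx
    have h4 : |x| * |g₁ (x, w) - x * φ w| ≤ |x| * (C * |x| ^ 2) := by
      rw [← abs_mul]
      calc _ = |x * g₁ (x, w) - x ^ 2 * φ w| := by ring_nf
        _ ≤ _ := h3
        _ = _ := by ring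
    have h5 := le_of_mul_le_mul_left h4 hx'
    rw [sub_zero, ← abs_mul]
    have := abs_sub_abs_le_abs_sub (g₁ (x, w)) (x * φ w)
    linarith)
  refine ⟨g, hg, ?_, ?_⟩
  · filter_upwards [hfg₁, hg₁g] with p h1 h2
    rw [h1, h2]; ring
  · filter_upwards [hpt.eventually hg, hline hfg₁, hline hg₁g, hline h] with w h1 h2 h2' h3
    refine eq_of_norm_sub_le h1.continuousAt (b := fun x => C * |x|)
      ((by fun_prop : Continuous fun x : ℝ => C * |x|).tendsto' 0 _ (by simp)) ?_
    filter_upwards [h2, h2', h3, hne] with x h2 h2' h3 hx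
    rw [h2, h2'] at h3
    have hx' : 0 < |x| ^ 2 := pow_pos (abs_pos.2 hx) 2
    refine le_of_mul_le_mul_left ?_ hx'
    rw [← abs_pow, ← abs_mul, abs_pow]
    calc _ = |x * (x * g (x, w)) - x ^ 2 * φ w| := by ring_nf
      _ ≤ _ := h3
      _ = _ := by ring

end Division

/-! ### Planar weak saddles: gaining powers of x. -/

section Planar

theorem hasDerivAt_snd_line {β : ℝ × ℝ → ℝ} (h : DifferentiableAt ℝ β 0) :
    HasDerivAt (fun w => β (0, w)) (fderiv ℝ β 0 (0, 1)) 0 :=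
  HasFDerivAt.comp_hasDerivAt_of_eq (0 : ℝ) h.hasFDerivAt
    ((hasDerivAt_const (0 : ℝ) (0 : ℝ)).prodMk (hasDerivAt_id (0 : ℝ))) rfl

theorem WeakSaddle.of_hasDerivAt {α : ℝ × ℝ → ℝ} {β : ℝ × ℝ → ℝ} {κ : ℝ}
    (hα : ∀ᶠ p in 𝓝 0, ContDiffAt ℝ ∞ α p) (hβ : ∀ᶠ p in 𝓝 0, ContDiffAt ℝ ∞ β p) (hα0 : α 0 = 1)
    (hβ0 : β 0 = 0) (hκ : 0 < κ) (hd : HasDerivAt (fun w => β (0, w)) κ 0) :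
    WeakSaddle α β := by
  refine ⟨hα, hβ, hα0, hβ0, κ, hκ, ?_⟩
  have hκ' := (hasDerivAt_snd_line (hβ.self_of_nhds.differentiableAt (by simp))).unique hd
  filter_upwards [Ioo_mem_nhdsGT (by positivity : 0 < 1 / κ)] with t ht z
  have h1 : ((0 : ℝ), z) = z • ((0 : ℝ), (1 : ℝ)) := by simp
  have h2 : κ * t < 1 := by
    have := ht.2
    rw [lt_div_iff₀ hκ] at this
    linarith
  rw [h1, map_smul, hκ']
  have h3 : z - t • z • κ = (1 - κ * t) * z := by simp only [smul_eq_mul]; ring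
  rw [h3, norm_mul, Real.norm_eq_abs (1 - κ * t), abs_of_pos (by linarith)]

theorem WeakSaddle.fderiv_pos {α β : ℝ × ℝ → ℝ} (h : WeakSaddle α β) :
    0 < fderiv ℝ β 0 (0, 1) := by
  obtain ⟨c, hc, hcon⟩ := h.contracting
  obtain ⟨t, h1, ht⟩ := (hcon.and self_mem_nhdsWithin).exists
  have ht : 0 < t := ht
  have h2 := (le_abs_self _).trans (h1 1)
  simp only [smul_eq_mul, norm_one, mul_one] at h2
  have : 0 < t * fderiv ℝ β 0 (0, 1) := by nlinarith
  exact pos_of_mul_pos_right this ht.le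

theorem eventually_comp_of_zero {ψ : ℝ × ℝ → ℝ × ℝ} (hψ : Continuous ψ) (h0 : ψ 0 = 0)
    {P : ℝ × ℝ → Prop} (h : ∀ᶠ p in 𝓝 0, P p) : ∀ᶠ p in 𝓝 0, P (ψ p) :=
  (hψ.tendsto' 0 0 h0).eventually h

theorem eventually_one_add_mul_pos {α : ℝ × ℝ → ℝ} (hα : ContinuousAt α 0) :
    ∀ᶠ p in 𝓝 0, 0 < 1 + p.1 * α p :=
  (continuousAt_const.add (continuousAt_fst.mul hα)).eventually_const_lt (by simp)

/-- The substitution `z = a x² + x w` turns a planar weak saddle into another one. -/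
theorem WeakSaddle.exists_shift {α β : ℝ × ℝ → ℝ} (h : WeakSaddle α β) :
    ∃ (a : ℝ) (α' β' : ℝ × ℝ → ℝ), WeakSaddle α' β' ∧
      ∀ᶠ p in 𝓝 0, α' p = α (p.1, a * p.1 ^ 2 + p.1 * p.2) ∧
        -(a * p.1 ^ 2 + p.1 * p.2) + p.1 * β (p.1, a * p.1 ^ 2 + p.1 * p.2) =
          a * (p.1 + p.1 ^ 2 * α' p) ^ 2 + (p.1 + p.1 ^ 2 * α' p) * (-p.2 + p.1 * β' p) := by
  -- This is the quadratic coefficient of a formal invariant curve; it makes the new β vanish at 0.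
  set a := fderiv ℝ β 0 (1, 0) / 2 with ha
  set κ := fderiv ℝ β 0 (0, 1) with hκ_def
  have hκ : 0 < κ := h.fderiv_pos
  let ψ : ℝ × ℝ → ℝ × ℝ := fun p => (p.1, a * p.1 ^ 2 + p.1 * p.2)
  have hψ : ContDiff ℝ ∞ ψ := by fun_prop
  have hψ0 : ψ 0 = 0 := by simp [ψ]
  have hψw : ∀ w, ψ (0, w) = 0 := fun w => by simp [ψ]
  have hα' : ∀ᶠ p in 𝓝 0, ContDiffAt ℝ ∞ (fun p => α (ψ p)) p := by
    filter_upwards [eventually_comp_of_zero hψ.continuous hψ0 h.smooth_fst] with p hp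
    exact hp.comp p hψ.contDiffAt
  have hβψ : ∀ᶠ p in 𝓝 0, ContDiffAt ℝ ∞ (fun p => β (ψ p)) p := by
    filter_upwards [eventually_comp_of_zero hψ.continuous hψ0 h.smooth_snd] with p hp
    exact hp.comp p hψ.contDiffAt
  obtain ⟨b, hb, hβb⟩ := exists_eventually_eq_mul hβψ
    (.of_forall fun w => by rw [hψw, h.snd_zero])
  have hpt : Tendsto (fun w : ℝ => ((0 : ℝ), w)) (𝓝 0) (𝓝 0) :=
    (by fun_prop : Continuous fun w : ℝ => ((0 : ℝ), w)).tendsto' 0 _ rfl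
  have hb0 : ∀ᶠ w in 𝓝 0, b (0, w) = 2 * a + κ * w := by
    filter_upwards [hpt.eventually hβb.eventually_nhds, hpt.eventually hb] with w h1 h2
    have hx : Tendsto (fun x : ℝ => (x, w)) (𝓝 0) (𝓝 (0, w)) :=
      (by fun_prop : Continuous fun x : ℝ => (x, w)).tendsto' 0 _ rfl
    have hl : HasDerivAt (fun x : ℝ => (x, w)) (1, 0) 0 :=
      (hasDerivAt_id' (0 : ℝ)).prodMk (hasDerivAt_const _ _)
    have d1 : HasDerivAt (fun x => β (ψ (x, w))) (fderiv ℝ β 0 (1, w)) 0 := by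
      have hq : HasDerivAt (fun x : ℝ => ψ (x, w)) (1, w) 0 := by
        have := (hasDerivAt_id' (0 : ℝ)).prodMk
          ((((hasDerivAt_id' (0 : ℝ)).fun_pow 2).const_mul a).fun_add
            ((hasDerivAt_id' (0 : ℝ)).mul_const w))
        simpa using this
      exact HasFDerivAt.comp_hasDerivAt_of_eq (0 : ℝ)
        (h.smooth_snd.self_of_nhds.differentiableAt (by simp)).hasFDerivAt hq (hψw w).symm
    have d2 : HasDerivAt (fun x => x * b (x, w)) (b (0, w)) 0 := by
      have hd := HasFDerivAt.comp_hasDerivAt (0 : ℝ)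
        (h2.differentiableAt (by simp)).hasFDerivAt hl
      simpa using (hasDerivAt_id' (0 : ℝ)).fun_mul hd
    have h3 := (d2.congr_of_eventuallyEq (hx.eventually h1)).unique d1
    have h4 : ((1 : ℝ), w) = ((1 : ℝ), (0 : ℝ)) + w • ((0 : ℝ), (1 : ℝ)) := by simp
    rw [h3, h4, map_add, map_smul, ha, hκ_def, smul_eq_mul]
    ring
  have hu := eventually_one_add_mul_pos hα'.self_of_nhds.continuousAt
  -- Solving the relation for β' after dividing by x². On x = 0 it equals (2a + κw) - a - a + w = (κ
  -- + 1)w, so the contraction rate rises by one.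
  refine ⟨a, fun p => α (ψ p), fun p => (b p - a - a * (1 + p.1 * α (ψ p)) ^ 2 + p.2 * α (ψ p)) /
    (1 + p.1 * α (ψ p)), .of_hasDerivAt (κ := κ + 1) hα' ?_ ?_ ?_ (by positivity) ?_, ?_⟩
  · filter_upwards [hα', hb, hu] with p h1 h2 h3
    have h4 : ContDiffAt ℝ ∞ (fun p : ℝ × ℝ => 1 + p.1 * α (ψ p)) p :=
      contDiffAt_const.add (contDiffAt_fst.mul h1)
    exact (((h2.sub contDiffAt_const).sub (contDiffAt_const.mul (h4.pow 2))).add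
      (contDiffAt_snd.mul h1)).div h4 h3.ne'
  · rw [hψ0, h.fst_zero]
  · have := hb0.self_of_nhds
    simp only [← Prod.zero_eq_mk, mul_zero, add_zero] at this
    simp only [this, Prod.fst_zero, Prod.snd_zero]
    ring
  · have : HasDerivAt (fun w => (κ + 1) * w) (κ + 1) 0 := by
      simpa using (hasDerivAt_id' (0 : ℝ)).const_mul (κ + 1)
    refine this.congr_of_eventuallyEq ?_
    filter_upwards [hb0] with w hw
    rw [hψw, h.fst_zero, hw]
    ring
  · filter_upwards [hβb, hu] with p h1 h2
    refine ⟨rfl, ?_⟩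
    change -(a * p.1 ^ 2 + p.1 * p.2) + p.1 * β (ψ p) = _
    rw [h1]
    field_simp
    ring

/-- Each shift multiplies the remainder η by another x without touching its regularity, so m shifts
leave x^m to absorb the powers of x lost in differentiation. -/
theorem WeakSaddle.exists_smooth_invariant (k m : ℕ) : ∀ {α β : ℝ × ℝ → ℝ}, WeakSaddle α β →
    ∃ ζ Q η : ℝ → ℝ, ContDiff ℝ ∞ Q ∧ (∀ x, ζ x = Q x + x ^ m * η x) ∧
      Tendsto ζ (𝓝[>] 0) (𝓝 0) ∧ (∀ᶠ x in 𝓝[>] 0, ζ (baseMap α ζ x) = fibreMap β ζ x) ∧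
      (∃ δ > 0, ∀ N > k, ContDiffOn ℝ k (flatExt N η) (Iio δ)) ∧
      (1 ≤ m → ζ =o[𝓝[>] 0] fun x => x) ∧ (2 ≤ m → ζ =O[𝓝[>] 0] fun x => x ^ 2) := by
  induction m with
  | zero =>
    intro α β h
    obtain ⟨ζ, hlim, hinv, hreg⟩ := h.exists_invariant k
    exact ⟨ζ, 0, ζ, contDiff_const, fun x => by simp, hlim, hinv, hreg, by simp, by simp⟩
  | succ m ih =>
    intro α β h
    obtain ⟨a, α', β', h', hrel⟩ := h.exists_shift
    obtain ⟨ζ, Q, η, hQ, hζ, hlim, hinv, hreg, h1, -⟩ := ih h'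
    have hx0 : Tendsto (fun x : ℝ => x) (𝓝[>] 0) (𝓝 0) := tendsto_id.mono_left nhdsWithin_le_nhds
    have hpair : Tendsto (fun x => (x, ζ x)) (𝓝[>] 0) (𝓝 0) := hx0.prodMk_nhds hlim
    have hlittle : ∀ {n : ℕ}, (fun x : ℝ => a * x ^ (n + 2)) =o[𝓝[>] 0] fun x => x ^ (n + 1) := by
      intro n
      exact ((isLittleO_pow_pow (by omega)).mono nhdsWithin_le_nhds).const_mul_left a
    have e1 : (fun x => a * x ^ 2 + x * ζ x) =o[𝓝[>] 0] fun x => x := by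
      refine .add (by simpa using hlittle (n := 0)) ?_
      simpa using (isBigO_refl (fun x : ℝ => x) (𝓝[>] 0)).mul_isLittleO
        ((isLittleO_one_iff ℝ).2 hlim)
    refine ⟨fun x => a * x ^ 2 + x * ζ x, fun x => a * x ^ 2 + x * Q x, η,
      (contDiff_const.mul (contDiff_id.pow 2)).add (contDiff_id.mul hQ), fun x => ?_,
      e1.trans_tendsto hx0, ?_, hreg, fun _ => e1, fun hm => ?_⟩
    · simp only [hζ x]; ring
    · filter_upwards [hpair.eventually hrel, hinv] with x hx hx'
      obtain ⟨hx1, hx2⟩ := hx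
      have hb : baseMap α (fun x => a * x ^ 2 + x * ζ x) x = baseMap α' ζ x := by
        simp only [baseMap, hx1]
      simp only [hb, hx']
      simp only [fibreMap, smul_eq_mul, hx2, baseMap]
    · refine .add ?_ ?_
      · exact (isBigO_refl _ _).const_mul_left a
      · simpa [sq] using (isBigO_refl (fun x : ℝ => x) (𝓝[>] 0)).mul (h1 (by omega)).isBigO

end Planar

/-! ### Blow-up of the map and invariant curves of finite smoothness. -/

section Curve

variable {Φ : ℝ × ℝ → ℝ × ℝ} {μ lam : ℝ}

/-- In the chart `y = x w` the map becomes a weak saddle. -/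
theorem HasDegenerateForm.exists_weakSaddle (hΦ : ∀ᶠ p in 𝓝 0, ContDiffAt ℝ ∞ Φ p) (hlam : 0 < lam)
    (hform : HasDegenerateForm Φ μ lam) : ∃ α β : ℝ × ℝ → ℝ, WeakSaddle α β ∧
      ∀ᶠ p in 𝓝 0, Φ (p.1, p.1 * p.2) =
        (p.1 + p.1 ^ 2 * α p, (p.1 + p.1 ^ 2 * α p) * (-p.2 + p.1 * β p)) := by
  let ψ : ℝ × ℝ → ℝ × ℝ := fun p => (p.1, p.1 * p.2)
  have hψ : ContDiff ℝ ∞ ψ := by fun_prop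
  have hψ0 : ψ 0 = 0 := by simp [ψ]
  have hΦψ : ∀ᶠ p in 𝓝 0, ContDiffAt ℝ ∞ (fun p => Φ (ψ p)) p := by
    filter_upwards [eventually_comp_of_zero hψ.continuous hψ0 hΦ] with p hp
    exact hp.comp p hψ.contDiffAt
  have hnorm : ∀ᶠ p : ℝ × ℝ in 𝓝 0, ‖ψ p‖ ≤ |p.1| := by
    filter_upwards [Metric.closedBall_mem_nhds (0 : ℝ × ℝ) one_pos] with p hp
    have : |p.2| ≤ 1 := (norm_snd_le p).trans (by simpa using hp)
    simp only [ψ, Prod.norm_def, Real.norm_eq_abs, abs_mul]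
    exact max_le le_rfl (mul_le_of_le_one_right (abs_nonneg _) this)
  have hbound : ∀ {f : ℝ × ℝ → ℝ}, f =O[𝓝 0] (fun p => ‖p‖ ^ 3) →
      ∃ C, ∀ᶠ p in 𝓝 0, |f (ψ p)| ≤ C * |p.1| ^ 3 := by
    intro f hf
    obtain ⟨C, hC, hf⟩ := hf.exists_nonneg
    refine ⟨C, ?_⟩
    filter_upwards [eventually_comp_of_zero hψ.continuous hψ0 hf.bound, hnorm] with p h1 h2
    refine h1.trans ?_
    rw [norm_pow, norm_norm]
    gcongr
  obtain ⟨C₁, h₁⟩ := hbound hform.1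
  obtain ⟨C₂, h₂⟩ := hbound hform.2
  obtain ⟨α, hα, hXα, hα0⟩ := exists_eventually_eq_sq_mul (f := fun p => (Φ (ψ p)).1 - p.1)
    (φ := fun w => 1 + μ * w) (C := C₁)
    (hΦψ.mono fun p hp => hp.fst.sub contDiffAt_fst)
    (h₁.mono fun p hp => by convert hp using 2; simp only [ψ]; ring)
  obtain ⟨γ, hγ, hYγ, hγ0⟩ := exists_eventually_eq_sq_mul (f := fun p => (Φ (ψ p)).2 + p.1 * p.2)
    (φ := fun w => lam * w) (C := C₂)
    (hΦψ.mono fun p hp => hp.snd.add (contDiffAt_fst.mul contDiffAt_snd))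
    (h₂.mono fun p hp => by convert hp using 2; simp only [ψ]; ring)
  have hu := eventually_one_add_mul_pos hα.self_of_nhds.continuousAt
  refine ⟨α, fun p => (γ p + p.2 * α p) / (1 + p.1 * α p),
    .of_hasDerivAt (κ := lam + 1) hα ?_ ?_ ?_ (by positivity) ?_, ?_⟩
  · filter_upwards [hα, hγ, hu] with p h1 h2 h3
    exact (h2.add (contDiffAt_snd.mul h1)).div (contDiffAt_const.add (contDiffAt_fst.mul h1)) h3.ne'
  · simpa [← Prod.zero_eq_mk] using hα0.self_of_nhds
  · have := hγ0.self_of_nhds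
    simp only [← Prod.zero_eq_mk, mul_zero] at this
    simp [this]
  · have : HasDerivAt (fun w => lam * w + w * (1 + μ * w)) (lam + 1) 0 := by
      have h1 := (hasDerivAt_id' (0 : ℝ)).const_mul lam
      have h2 := (hasDerivAt_id' (0 : ℝ)).fun_mul
        (((hasDerivAt_id' (0 : ℝ)).const_mul μ).const_add 1)
      simpa using h1.fun_add h2
    refine this.congr_of_eventuallyEq ?_
    filter_upwards [hα0, hγ0] with w h1 h2
    simp [h1, h2]
  · filter_upwards [hXα, hYγ, hu] with p h1 h2 h3
    change Φ (ψ p) = _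
    refine Prod.ext ?_ ?_
    · simp only; linarith
    · have : (Φ (ψ p)).2 = p.1 ^ 2 * γ p - p.1 * p.2 := by linarith
      rw [this]
      simp only
      field_simp
      ring

/-- In the original plane the curve is x ζ(x). For x ≤ 0 it is continued by x Q(x), which makes it
`C^k` on both sides of 0. -/
theorem HasDegenerateForm.exists_curve (hΦ : ∀ᶠ p in 𝓝 0, ContDiffAt ℝ ∞ Φ p) (hlam : 0 < lam)
    (hform : HasDegenerateForm Φ μ lam) (k : ℕ) : ∃ F : ℝ → ℝ,
      (∃ δ > 0, ContDiffOn ℝ k F (Iio δ)) ∧ F =O[𝓝[≥] 0] (fun x => x ^ 3) ∧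
        ∀ᶠ x in 𝓝[>] 0, (Φ (x, F x)).2 = F (Φ (x, F x)).1 := by
  obtain ⟨α, β, h, hrel⟩ := hform.exists_weakSaddle hΦ hlam
  -- With m = k + 2 the remainder of x ζ carries x^(k+3), enough for k derivatives, and m ≥ 2 gives
  -- ζ = O(x²).
  obtain ⟨ζ, Q, η, hQ, hζ, hlim, hinv, ⟨δ, hδ, hreg⟩, -, hO⟩ := h.exists_smooth_invariant k (k + 2)
  have hx0 : Tendsto (fun x : ℝ => x) (𝓝[>] 0) (𝓝 0) := tendsto_id.mono_left nhdsWithin_le_nhds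
  have hpair : Tendsto (fun x => (x, ζ x)) (𝓝[>] 0) (𝓝 0) := hx0.prodMk_nhds hlim
  let F : ℝ → ℝ := fun x => x * Q x + flatExt (k + 3) η x
  have hF : ∀ {x : ℝ}, 0 < x → F x = x * ζ x := fun {x} hx => by
    simp only [F, flatExt_of_pos hx, hζ, smul_eq_mul]
    ring
  refine ⟨F, ⟨δ, hδ, ?_⟩, ?_, ?_⟩
  · exact ((contDiff_id.mul hQ).of_le (by exact_mod_cast le_top)).contDiffOn.add
      (hreg _ (by omega))
  · rw [← Ioi_insert, nhdsWithin_insert]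
    refine IsBigO.sup ?_ ?_
    · exact .of_bound 0 (eventually_pure.2 (by simp [F, flatExt_of_nonpos]))
    · refine ((isBigO_refl (fun x : ℝ => x) (𝓝[>] 0)).mul (hO (by omega))).congr' ?_ ?_
      · filter_upwards [self_mem_nhdsWithin] with x hx using (hF hx).symm
      · exact .of_forall fun x => by ring
  · have hu := eventually_one_add_mul_pos h.smooth_fst.self_of_nhds.continuousAt
    filter_upwards [hpair.eventually hrel, hpair.eventually hu, hinv, self_mem_nhdsWithin]
      with x h1 h2 h3 hx
    have hx : 0 < x := hx
    have hX : 0 < baseMap α ζ x := by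
      have := mul_pos hx h2
      rw [baseMap]
      linarith
    rw [hF hx, h1]
    change baseMap α ζ x * _ = F (baseMap α ζ x)
    rw [hF hX, h3]
    rfl

end Curve

/-! ### Estimates for curves of size o(x^(2/3)). -/

section Uniqueness

/-- A smooth function of size `‖p‖³` has Lipschitz constant of order `r ^ (3 / 2)` on the ball of
radius `r`. -/
theorem exists_lipschitz_of_isBigO_cube {f : ℝ × ℝ → ℝ} (hf : ∀ᶠ p in 𝓝 0, ContDiffAt ℝ ∞ f p)
    (hO : f =O[𝓝 0] fun p => ‖p‖ ^ 3) : ∃ C, ∃ ρ > 0, ∀ r, 0 < r → r < ρ → ∀ p q,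
      ‖p‖ ≤ r → ‖q‖ ≤ r → |f p - f q| ≤ C * √(r ^ 3) * ‖p - q‖ := by
  obtain ⟨C, hC, hO⟩ := hO.exists_nonneg
  have hfd : ContDiffAt ℝ 1 (fderiv ℝ f) 0 :=
    (hf.self_of_nhds.fderiv_right (m := ∞) (by simp)).of_le (by exact_mod_cast le_top)
  obtain ⟨K, t, ht, hK⟩ := hfd.exists_lipschitzOnWith
  obtain ⟨ρ, hρ, h⟩ := Metric.eventually_nhds_iff_ball.1
    ((hf.and hO.bound).and (eventually_mem_set.2 ht))
  have hρ' : 0 < min (ρ / 2) 1 := by positivity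
  refine ⟨9 * C + K, _, hρ', fun r hr hrρ => ?_⟩
  have hr1 : r < 1 := hrρ.trans_le (min_le_right _ _)
  have hrρ : 2 * r < ρ := by linarith [hrρ.trans_le (min_le_left _ _)]
  -- A Taylor step of length s balances the size r³ = s² of f against the second-order error K s²; s
  -- ≤ r keeps the step inside radius 2r.
  set s := √(r ^ 3) with hs_def
  have hs : 0 < s := Real.sqrt_pos.2 (by positivity)
  have hs2 : s ^ 2 = r ^ 3 := Real.sq_sqrt (by positivity)
  have hsr : s ≤ r := by
    refine Real.sqrt_le_iff.2 ⟨hr.le, ?_⟩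
    nlinarith [pow_pos hr 2]
  have hball : ∀ p, ‖p‖ ≤ 2 * r → p ∈ Metric.ball (0 : ℝ × ℝ) ρ := fun p hp => by
    rw [mem_ball_zero_iff]; linarith
  have hfb : ∀ p, ‖p‖ ≤ 2 * r → |f p| ≤ C * (8 * r ^ 3) := fun p hp => by
    refine (h p (hball p hp)).1.2.trans ?_
    rw [norm_pow, norm_norm]
    have : ‖p‖ ^ 3 ≤ (2 * r) ^ 3 := by gcongr
    nlinarith
  have hgrad : ∀ p, ‖p‖ ≤ r → ‖fderiv ℝ f p‖ ≤ (9 * C + K) * s := by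
    intro p hp
    refine ContinuousLinearMap.opNorm_le_bound _ (by positivity) fun v => ?_
    rcases eq_or_ne v 0 with rfl | hv
    · simp
    have hv' : 0 < ‖v‖ := norm_pos_iff.2 hv
    set w := (s / ‖v‖) • v with hw_def
    have hw : ‖w‖ = s := by
      rw [hw_def, norm_smul, norm_div, norm_norm, Real.norm_eq_abs, abs_of_pos hs,
        div_mul_cancel₀ _ hv'.ne']
    have hsub : ∀ x ∈ Metric.closedBall p s, ‖x‖ ≤ 2 * r := fun x hx => by
      have := norm_le_of_mem_closedBall hx
      linarith
    have e1 : ‖f (p + w) - f p - fderiv ℝ f p ((p + w) - p)‖ ≤ K * s * ‖(p + w) - p‖ := by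
      refine (convex_closedBall p s).norm_image_sub_le_of_norm_fderiv_le' (𝕜 := ℝ)
        (fun x hx => (h x (hball x (hsub x hx))).1.1.differentiableAt (by simp)) (fun x hx => ?_)
        (Metric.mem_closedBall_self hs.le) (by simp [hw])
      refine (hK.norm_sub_le (h x (hball x (hsub x hx))).2 (h p (hball p (by linarith))).2).trans ?_
      rw [mem_closedBall_iff_norm] at hx
      gcongr
    rw [add_sub_cancel_left, hw] at e1
    have e2 : |fderiv ℝ f p w| ≤ (9 * C + K) * s ^ 2 := by
      have h1 := hfb (p + w) ((norm_add_le _ _).trans (by rw [hw]; linarith))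
      have h2 : |f p| ≤ C * r ^ 3 := by
        refine (h p (hball p (by linarith))).1.2.trans ?_
        rw [norm_pow, norm_norm]
        gcongr
      rw [Real.norm_eq_abs] at e1
      rw [abs_le] at e1 h1 h2 ⊢
      constructor <;> nlinarith
    rw [hw_def, map_smul, smul_eq_mul, abs_mul, abs_of_pos (by positivity : 0 < s / ‖v‖)] at e2
    rw [div_mul_eq_mul_div, div_le_iff₀ hv'] at e2
    refine le_of_mul_le_mul_left ?_ hs
    rw [Real.norm_eq_abs]
    linarith
  intro p q hp hq
  refine (convex_closedBall (0 : ℝ × ℝ) r).norm_image_sub_le_of_norm_fderiv_le (𝕜 := ℝ)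
    (fun x hx => (h x (hball x ?_)).1.1.differentiableAt (by simp)) (fun x hx => hgrad x ?_)
    (mem_closedBall_zero_iff.2 hq) (mem_closedBall_zero_iff.2 hp)
  · have := mem_closedBall_zero_iff.1 hx
    linarith
  · exact mem_closedBall_zero_iff.1 hx

theorem pow_isLittleO_nhdsGT {m n : ℕ} (h : m < n) :
    (fun x : ℝ => x ^ n) =o[𝓝[>] 0] fun x => x ^ m :=
  (isLittleO_pow_pow h).mono nhdsWithin_le_nhds

variable {G : ℝ → ℝ}

theorem tendsto_zero_of_cube_isLittleO (hG : (fun x => G x ^ 3) =o[𝓝[>] 0] fun x => x ^ 2) :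
    Tendsto G (𝓝[>] 0) (𝓝 0) := by
  have h1 : (fun x : ℝ => x ^ 2) =O[𝓝[>] 0] fun _ => (1 : ℝ) ^ 3 := by
    have := (pow_isLittleO_nhdsGT (m := 0) (n := 2) (by norm_num)).isBigO
    simpa using this
  exact (isLittleO_one_iff ℝ).1 (IsLittleO.of_pow (n := 3) (hG.trans_isBigO h1) (by norm_num))

theorem sq_isLittleO_of_cube_isLittleO (hG : (fun x => G x ^ 3) =o[𝓝[>] 0] fun x => x ^ 2) :
    (fun x => G x ^ 2) =o[𝓝[>] 0] fun x => x := by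
  refine IsLittleO.of_pow (n := 3) ?_ (by norm_num)
  have h1 := hG.pow (n := 2) (by norm_num)
  have h2 : (fun x : ℝ => (x ^ 2) ^ 2) =o[𝓝[>] 0] fun x => x ^ 3 := by
    simpa only [← pow_mul] using pow_isLittleO_nhdsGT (m := 3) (n := 4) (by norm_num)
  refine (h1.trans h2).congr_left fun x => by simp only [Pi.pow_apply]; ring

theorem tendsto_pair_of_cube_isLittleO (hG : (fun x => G x ^ 3) =o[𝓝[>] 0] fun x => x ^ 2) :
    Tendsto (fun x => (x, G x)) (𝓝[>] 0) (𝓝 0) :=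
  (tendsto_id.mono_left nhdsWithin_le_nhds).prodMk_nhds (tendsto_zero_of_cube_isLittleO hG)

theorem norm_cube_isLittleO (hG : (fun x => G x ^ 3) =o[𝓝[>] 0] fun x => x ^ 2) :
    (fun x => ‖(x, G x)‖ ^ 3) =o[𝓝[>] 0] fun x => x ^ 2 := by
  rw [isLittleO_iff] at hG ⊢
  intro c hc
  have h1 := (isLittleO_iff.1 (pow_isLittleO_nhdsGT (m := 2) (n := 3) (by norm_num))) hc
  filter_upwards [hG hc, h1] with x h1 h2
  rw [norm_pow, norm_norm, Prod.norm_def]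
  rw [norm_pow] at h1 h2
  rcases max_cases ‖x‖ ‖G x‖ with ⟨h, -⟩ | ⟨h, -⟩
  · simp only [h]; exact h2
  · simp only [h]; exact h1

theorem isLittleO_comp_graph {f : ℝ × ℝ → ℝ} (hf : f =O[𝓝 0] fun p => ‖p‖ ^ 3)
    (hG : (fun x => G x ^ 3) =o[𝓝[>] 0] fun x => x ^ 2) :
    (fun x => f (x, G x)) =o[𝓝[>] 0] fun x => x ^ 2 :=
  (hf.comp_tendsto (tendsto_pair_of_cube_isLittleO hG)).trans_isLittleO (norm_cube_isLittleO hG)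

end Uniqueness

/-! ### Uniqueness through backward orbits. -/

section Uniqueness

variable {Φ : ℝ × ℝ → ℝ × ℝ} {μ lam : ℝ} {F G : ℝ → ℝ}

/-- Since Y ≈ -y, the product XY contributes -xy, turning μxy into (μ/2)xy. Everything else besides
x² is o(x²), because G² = o(x) and the cubic remainders are o(x²). -/
theorem HasDegenerateForm.eventually_lyapunov (hform : HasDegenerateForm Φ μ lam)
    (hG : (fun x => G x ^ 3) =o[𝓝[>] 0] fun x => x ^ 2) : ∀ᶠ x in 𝓝[>] 0,
      x + μ / 2 * (x * G x) + x ^ 2 / 2 ≤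
        (Φ (x, G x)).1 + μ / 2 * ((Φ (x, G x)).1 * (Φ (x, G x)).2) := by
  have h1 := isLittleO_comp_graph hform.1 hG
  have h2 := isLittleO_comp_graph hform.2 hG
  have hG0 := tendsto_zero_of_cube_isLittleO hG
  have hGsq := sq_isLittleO_of_cube_isLittleO hG
  set e₁ := fun x => (Φ (x, G x)).1 - (x + x ^ 2 + μ * x * G x) with he₁
  set e₂ := fun x => (Φ (x, G x)).2 - (-G x + lam * x * G x) with he₂
  have hx0 : Tendsto (fun x : ℝ => x) (𝓝[>] 0) (𝓝 0) := tendsto_id.mono_left nhdsWithin_le_nhds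
  have hx : (fun x : ℝ => x) =O[𝓝[>] 0] fun x => x := isBigO_refl _ _
  have hxx : (fun x : ℝ => x ^ 2) =O[𝓝[>] 0] fun x => x ^ 2 := isBigO_refl _ _
  have ho : ∀ {f : ℝ → ℝ}, Tendsto f (𝓝[>] 0) (𝓝 0) → f =o[𝓝[>] 0] fun _ => (1 : ℝ) :=
    fun hf => (isLittleO_one_iff ℝ).2 hf
  have hsq0 : Tendsto (fun x : ℝ => x ^ 2) (𝓝[>] 0) (𝓝 0) := by simpa using hx0.pow 2
  have he₂0 : Tendsto e₂ (𝓝[>] 0) (𝓝 0) := h2.trans_tendsto hsq0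
  let Y : ℝ → ℝ := fun x => -G x + lam * x * G x + e₂ x
  have hY0 : Tendsto Y (𝓝[>] 0) (𝓝 0) := by
    have := (hG0.neg.add ((hx0.const_mul lam).mul hG0)).add he₂0
    simpa using this
  have t1 : (fun x => x ^ 2 * G x) =o[𝓝[>] 0] fun x => x ^ 2 := by
    simpa using hxx.mul_isLittleO (ho hG0)
  have t2 : (fun x => x * e₂ x) =o[𝓝[>] 0] fun x => x ^ 2 := by
    simpa using (ho hx0).mul_isBigO h2.isBigO
  have t3 : (fun x => (x ^ 2 + e₁ x) * Y x) =o[𝓝[>] 0] fun x => x ^ 2 := by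
    simpa using (hxx.add h1.isBigO).mul_isLittleO (ho hY0)
  have t4 : (fun x => x * (G x * Y x)) =o[𝓝[>] 0] fun x => x ^ 2 := by
    have h3 : (fun x => G x * Y x) =o[𝓝[>] 0] fun x => x := by
      have u1 : (fun x => x * G x ^ 2) =o[𝓝[>] 0] fun x => x := by
        simpa using hx.mul_isLittleO (ho (by simpa using hG0.pow 2))
      have u2 : (fun x => G x * e₂ x) =o[𝓝[>] 0] fun x => x := by
        have := (ho hG0).mul (h2.trans (pow_isLittleO_nhdsGT (m := 1) (n := 2) (by norm_num)))
        simpa using this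
      refine ((hGsq.neg_left.add (u1.const_mul_left lam)).add u2).congr_left fun x => ?_
      simp only [Y]; ring
    simpa [sq] using hx.mul_isLittleO h3
  have hE := h1.add ((((t1.const_mul_left lam).add t2).add t3 |>.add
    (t4.const_mul_left μ)).const_mul_left (μ / 2))
  filter_upwards [hE.def (by norm_num : (0 : ℝ) < 1 / 2)] with x hx
  have hX : (Φ (x, G x)).1 = x + x ^ 2 + μ * x * G x + e₁ x := by simp only [he₁]; ring
  have hYx : (Φ (x, G x)).2 = Y x := by simp only [Y, he₂]; ring
  rw [hX, hYx]
  rw [Real.norm_eq_abs, Real.norm_eq_abs, abs_of_nonneg (sq_nonneg x)] at hx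
  have h3 := (abs_le.1 hx).1
  have h4 : (x + x ^ 2 + μ * x * G x + e₁ x) * Y x = -(x * G x) + (lam * (x ^ 2 * G x) + x * e₂ x
      + (x ^ 2 + e₁ x) * Y x + μ * (x * (G x * Y x))) := by
    simp only [Y]; ring
  rw [h4]
  linarith

/-- With d the distance at x, the vertical images differ by at most (1 - λx)d + (λ/4)xd. The
horizontal ones differ by at most (|μ| + 1)xd, and the small slope of F turns this into another
(λ/4)xd. -/
theorem HasDegenerateForm.exists_contraction (hΦ : ∀ᶠ p in 𝓝 0, ContDiffAt ℝ ∞ Φ p)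
    (hlam : 0 < lam) (hform : HasDegenerateForm Φ μ lam)
    (hlip : ∀ κ > 0, ∃ δ > 0, ∀ s ∈ Ioo 0 δ, ∀ t ∈ Ioo 0 δ, |F s - F t| ≤ κ * |s - t|)
    (hF : (fun x => F x ^ 3) =o[𝓝[>] 0] fun x => x ^ 2)
    (hinv : ∀ᶠ x in 𝓝[>] 0, (Φ (x, F x)).2 = F (Φ (x, F x)).1)
    (hG : (fun x => G x ^ 3) =o[𝓝[>] 0] fun x => x ^ 2) :
    ∃ δ > 0, ∀ x ∈ Ioo 0 δ, (Φ (x, G x)).1 ∈ Ioo 0 δ →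
      |(Φ (x, G x)).2 - F (Φ (x, G x)).1| ≤ |G x - F x| := by
  have hX : ∀ᶠ p in 𝓝 0, ContDiffAt ℝ ∞ (fun p => (Φ p).1 - (p.1 + p.1 ^ 2 + μ * p.1 * p.2)) p :=
    hΦ.mono fun p hp => hp.fst.sub (by fun_prop)
  have hY : ∀ᶠ p in 𝓝 0, ContDiffAt ℝ ∞ (fun p => (Φ p).2 - (-p.2 + lam * p.1 * p.2)) p :=
    hΦ.mono fun p hp => hp.snd.sub (by fun_prop)
  obtain ⟨C₁, ρ₁, hρ₁, hX⟩ := exists_lipschitz_of_isBigO_cube hX hform.1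
  obtain ⟨C₂, ρ₂, hρ₂, hY⟩ := exists_lipschitz_of_isBigO_cube hY hform.2
  have hx0 : Tendsto (fun x : ℝ => x) (𝓝[>] 0) (𝓝 0) := tendsto_id.mono_left nhdsWithin_le_nhds
  have hF0 := tendsto_zero_of_cube_isLittleO hF
  let r : ℝ → ℝ := fun x => max ‖(x, G x)‖ ‖(x, F x)‖
  have hr0 : Tendsto r (𝓝[>] 0) (𝓝 0) := by
    have := (tendsto_pair_of_cube_isLittleO hG).norm.max (tendsto_pair_of_cube_isLittleO hF).norm
    simpa only [norm_zero, max_self] using this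
  have hr3 : (fun x => r x ^ 3) =o[𝓝[>] 0] fun x => x ^ 2 := by
    rw [isLittleO_iff]
    intro c hc
    filter_upwards [(norm_cube_isLittleO hG).def hc, (norm_cube_isLittleO hF).def hc] with x h1 h2
    rcases max_cases ‖(x, G x)‖ ‖(x, F x)‖ with ⟨h, -⟩ | ⟨h, -⟩
    · simp only [r, h]; exact h1
    · simp only [r, h]; exact h2
  have hs : (fun x => √(r x ^ 3)) =o[𝓝[>] 0] fun x => x := by
    refine IsLittleO.of_pow (n := 2) (hr3.congr_left fun x => ?_) (by norm_num)
    rw [Pi.pow_apply, Real.sq_sqrt]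
    have : 0 ≤ r x := (norm_nonneg _).trans (le_max_left _ _)
    positivity
  have hs1 := (hs.const_mul_left C₁).def (one_pos)
  have hs2 := (hs.const_mul_left C₂).def (by positivity : 0 < lam / 4)
  obtain ⟨δ₀, hδ₀, hlip⟩ := hlip (lam / (4 * (|μ| + 1))) (by positivity)
  have hX₀ : ∀ᶠ x in 𝓝[>] 0, (Φ (x, F x)).1 ∈ Ioo 0 δ₀ := by
    have h1 := isLittleO_comp_graph hform.1 hF
    have h2 : (fun x => (Φ (x, F x)).1 - x) =o[𝓝[>] 0] fun x => x := by
      have u1 : (fun x : ℝ => x ^ 2) =o[𝓝[>] 0] fun x => x := by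
        simpa using pow_isLittleO_nhdsGT (m := 1) (n := 2) (by norm_num)
      have u2 : (fun x => x * F x) =o[𝓝[>] 0] fun x => x := by
        simpa using (isBigO_refl (fun x : ℝ => x) (𝓝[>] 0)).mul_isLittleO
          ((isLittleO_one_iff ℝ).2 hF0)
      refine (((h1.trans u1).add u1).add (u2.const_mul_left μ)).congr_left fun x => ?_
      ring
    filter_upwards [h2.def (by norm_num : (0 : ℝ) < 1 / 2),
      Ioo_mem_nhdsGT (by positivity : 0 < δ₀ / 2)] with x h3 h4
    rw [Real.norm_eq_abs, Real.norm_eq_abs, abs_of_pos h4.1, abs_le] at h3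
    exact ⟨by linarith [h4.1], by linarith [h4.2]⟩
  have hrpos : ∀ᶠ x in 𝓝[>] 0, r x < min ρ₁ ρ₂ := hr0.eventually_lt_const (lt_min hρ₁ hρ₂)
  have hsmall : ∀ᶠ x in 𝓝[>] 0, x < 1 / lam := hx0.eventually_lt_const (by positivity)
  have hev := hs1.and (hs2.and (hX₀.and (hrpos.and (hsmall.and hinv))))
  obtain ⟨δ₁, hδ₁, hev⟩ := mem_nhdsGT_iff_exists_Ioo_subset.1 hev
  have hδ₁ : 0 < δ₁ := hδ₁
  refine ⟨min δ₀ δ₁, lt_min hδ₀ hδ₁, fun x hx hXx => ?_⟩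
  obtain ⟨b1, b2, b3, b4, b5, b6⟩ := hev ⟨hx.1, hx.2.trans_le (min_le_right _ _)⟩
  have hxp := hx.1
  have hr : 0 < r x := by
    refine lt_of_lt_of_le ?_ (le_max_left _ _)
    exact norm_pos_iff.2 fun h => hxp.ne' (congrArg Prod.fst h)
  have c1 := hX (r x) hr (b4.trans_le (min_le_left _ _)) (x, G x) (x, F x) (le_max_left _ _)
    (le_max_right _ _)
  have c2 := hY (r x) hr (b4.trans_le (min_le_right _ _)) (x, G x) (x, F x) (le_max_left _ _)
    (le_max_right _ _)
  have hnorm : ‖(x, G x) - (x, F x)‖ = |G x - F x| := by simp [Prod.norm_def]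
  rw [hnorm] at c1 c2
  simp only [Real.norm_eq_abs, abs_of_pos hxp, one_mul] at b1 b2
  set d := |G x - F x| with hd
  have hd0 : 0 ≤ d := abs_nonneg _
  have c1' : C₁ * √(r x ^ 3) * d ≤ x * d :=
    mul_le_mul_of_nonneg_right ((le_abs_self _).trans b1) hd0
  have c2' : C₂ * √(r x ^ 3) * d ≤ lam / 4 * x * d :=
    mul_le_mul_of_nonneg_right ((le_abs_self _).trans b2) hd0
  have c3 : |(Φ (x, G x)).1 - (Φ (x, F x)).1| ≤ (|μ| + 1) * x * d := by
    have : (Φ (x, G x)).1 - (Φ (x, F x)).1 = μ * x * (G x - F x) +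
      (((Φ (x, G x)).1 - (x + x ^ 2 + μ * x * G x)) -
        ((Φ (x, F x)).1 - (x + x ^ 2 + μ * x * F x))) := by ring
    rw [this]
    refine (abs_add_le _ _).trans ?_
    rw [abs_mul, abs_mul, abs_of_pos hxp]
    linarith [c1.trans c1']
  have c4 : |(Φ (x, G x)).2 - (Φ (x, F x)).2| ≤ (1 - lam * x) * d + lam / 4 * x * d := by
    have : (Φ (x, G x)).2 - (Φ (x, F x)).2 = -(1 - lam * x) * (G x - F x) +
      (((Φ (x, G x)).2 - (-G x + lam * x * G x)) -
        ((Φ (x, F x)).2 - (-F x + lam * x * F x))) := by ring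
    have hpos : 0 ≤ 1 - lam * x := by
      rw [lt_div_iff₀ hlam] at b5
      linarith
    rw [this]
    refine (abs_add_le _ _).trans ?_
    rw [abs_mul, abs_neg, abs_of_nonneg hpos]
    exact add_le_add le_rfl (c2.trans c2')
  have c5 := hlip _ b3 _ ⟨hXx.1, hXx.2.trans_le (min_le_left _ _)⟩
  rw [abs_sub_comm (Φ (x, F x)).1] at c5
  have c6 : lam / (4 * (|μ| + 1)) * |(Φ (x, G x)).1 - (Φ (x, F x)).1| ≤ lam / 4 * x * d := by
    calc _ ≤ lam / (4 * (|μ| + 1)) * ((|μ| + 1) * x * d) := by gcongr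
      _ = _ := by field_simp
  have : (Φ (x, G x)).2 - F (Φ (x, G x)).1 = ((Φ (x, G x)).2 - (Φ (x, F x)).2) +
      (F (Φ (x, F x)).1 - F (Φ (x, G x)).1) := by rw [← b6]; ring
  rw [this]
  refine (abs_add_le _ _).trans ?_
  have : 0 ≤ lam * x * d := by positivity
  linarith

/-- Along a backward orbit Λ decreases by at least half the square of the new abscissa and stays
nonnegative, so the abscissae tend to 0, where F and G do too, while |G - F| does not decrease. -/
theorem HasDegenerateForm.eventually_eq_of_backward (hΦ : ∀ᶠ p in 𝓝 0, ContDiffAt ℝ ∞ Φ p)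
    (hlam : 0 < lam) (hform : HasDegenerateForm Φ μ lam)
    (hlip : ∀ κ > 0, ∃ δ > 0, ∀ s ∈ Ioo 0 δ, ∀ t ∈ Ioo 0 δ, |F s - F t| ≤ κ * |s - t|)
    (hF : (fun x => F x ^ 3) =o[𝓝[>] 0] fun x => x ^ 2)
    (hinv : ∀ᶠ x in 𝓝[>] 0, (Φ (x, F x)).2 = F (Φ (x, F x)).1)
    (hG : (fun x => G x ^ 3) =o[𝓝[>] 0] fun x => x ^ 2)
    (hback : ∀ ρ > 0, ∀ᶠ x in 𝓝[>] 0, ∃ x' ∈ Ioo 0 ρ, Φ (x', G x') = (x, G x)) :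
    ∀ᶠ x in 𝓝[>] 0, G x = F x := by
  have hG0 := tendsto_zero_of_cube_isLittleO hG
  have hF0 := tendsto_zero_of_cube_isLittleO hF
  obtain ⟨δ₁, hδ₁, hcon⟩ := hform.exists_contraction hΦ hlam hlip hF hinv hG
  have hsmall : ∀ᶠ x in 𝓝[>] 0, |μ / 2 * G x| < 1 / 2 := by
    have := (hG0.const_mul (μ / 2)).abs
    rw [mul_zero, abs_zero] at this
    exact this.eventually_lt_const (by norm_num)
  obtain ⟨δ₂, hδ₂, h2⟩ := mem_nhdsGT_iff_exists_Ioo_subset.1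
    ((hform.eventually_lyapunov hG).and hsmall)
  have hδ₂ : 0 < δ₂ := hδ₂
  have hρ : 0 < min δ₁ δ₂ := lt_min hδ₁ hδ₂
  obtain ⟨δ₃, hδ₃, h3⟩ := mem_nhdsGT_iff_exists_Ioo_subset.1 (hback _ hρ)
  have hδ₃ : 0 < δ₃ := hδ₃
  set δ := min (min δ₁ δ₂) δ₃ with hδ_def
  have hδ : 0 < δ := lt_min hρ hδ₃
  have hb : ∀ x, ∃ x', x ∈ Ioo 0 δ → x' ∈ Ioo 0 (min δ₁ δ₂) ∧ Φ (x', G x') = (x, G x) := by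
    intro x
    by_cases hx : x ∈ Ioo 0 δ
    · obtain ⟨x', h, h'⟩ := h3 ⟨hx.1, hx.2.trans_le (min_le_right _ _)⟩
      exact ⟨x', fun _ => ⟨h, h'⟩⟩
    · exact ⟨0, fun h => (hx h).elim⟩
  choose b hb using hb
  let Λ : ℝ → ℝ := fun x => x + μ / 2 * (x * G x)
  have hΛ : ∀ x ∈ Ioo 0 (min δ₁ δ₂), x / 2 ≤ Λ x ∧ Λ x ≤ 3 / 2 * x := by
    intro x hx
    have := abs_lt.1 (h2 ⟨hx.1, hx.2.trans_le (min_le_right _ _)⟩).2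
    have h4 : Λ x = x * (1 + μ / 2 * G x) := by simp only [Λ]; ring
    rw [h4]
    constructor <;> nlinarith [hx.1]
  have hstep : ∀ x ∈ Ioo 0 δ, Λ (b x) + b x ^ 2 / 2 ≤ Λ x := by
    intro x hx
    obtain ⟨h4, h5⟩ := hb x hx
    have := (h2 ⟨h4.1, h4.2.trans_le (min_le_right _ _)⟩).1
    rw [h5] at this
    exact this
  -- As x/2 ≤ Λ ≤ 3x/2, an orbit starting at x never exceeds 3x, hence stays below δ.
  filter_upwards [Ioo_mem_nhdsGT (by positivity : 0 < δ / 3)] with x hx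
  have hx' : x ∈ Ioo 0 δ := ⟨hx.1, by linarith [hx.2]⟩
  let u : ℕ → ℝ := fun n => b^[n] x
  have hu : ∀ n, u (n + 1) = b (u n) := fun n => Function.iterate_succ_apply' b n x
  have hmem : ∀ n, u n ∈ Ioo 0 δ ∧ Λ (u n) ≤ Λ x := by
    intro n
    induction n with
    | zero => exact ⟨hx', le_rfl⟩
    | succ n ih =>
      have h4 := (hb _ ih.1).1
      have h5 := hstep _ ih.1
      rw [← hu] at h4 h5
      have h6 : Λ (u (n + 1)) ≤ Λ x := by linarith [ih.2, sq_nonneg (u (n + 1))]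
      have h7 := (hΛ _ h4).1
      have h8 := (hΛ x ⟨hx.1, hx'.2.trans_le (min_le_left _ _)⟩).2
      exact ⟨⟨h4.1, by linarith [hx.2]⟩, h6⟩
  have hδ' : ∀ {y}, y ∈ Ioo 0 δ → y ∈ Ioo 0 (min δ₁ δ₂) := fun hy =>
    ⟨hy.1, hy.2.trans_le (min_le_left _ _)⟩
  have hanti : Antitone fun n => Λ (u n) := antitone_nat_of_succ_le fun n => by
    have := hstep _ (hmem n).1
    rw [← hu] at this
    linarith [sq_nonneg (u (n + 1))]
  have hconv := tendsto_atTop_ciInf hanti ⟨0, by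
    rintro _ ⟨n, rfl⟩
    linarith [(hΛ _ (hδ' (hmem n).1)).1, (hmem n).1.1]⟩
  have hdiff := hconv.sub (hconv.comp (tendsto_add_atTop_nat 1))
  rw [sub_self] at hdiff
  have hsq : Tendsto (fun n => u (n + 1) ^ 2) atTop (𝓝 0) := by
    have h4 := hdiff.const_mul 2
    rw [mul_zero] at h4
    refine squeeze_zero (fun n => sq_nonneg _) (fun n => ?_) h4
    have := hstep _ (hmem n).1
    rw [← hu] at this
    simp only [Function.comp]
    linarith
  have hu0 : Tendsto (fun n => u (n + 1)) atTop (𝓝 0) := by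
    have := (Real.continuous_sqrt.tendsto 0).comp hsq
    rw [Real.sqrt_zero] at this
    refine this.congr fun n => ?_
    exact Real.sqrt_sq (hmem (n + 1)).1.1.le
  have hu0' : Tendsto (fun n => u (n + 1)) atTop (𝓝[>] 0) :=
    tendsto_nhdsWithin_iff.2 ⟨hu0, .of_forall fun n => (hmem (n + 1)).1.1⟩
  have hd : ∀ n, |G x - F x| ≤ |G (u n) - F (u n)| := by
    intro n
    induction n with
    | zero => exact le_rfl
    | succ n ih =>
      refine ih.trans ?_
      obtain ⟨h4, h5⟩ := hb _ (hmem n).1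
      have h6 := (hδ' (hmem n).1)
      have := hcon (b (u n)) ⟨h4.1, h4.2.trans_le (min_le_left _ _)⟩
        (by rw [h5]; exact ⟨h6.1, h6.2.trans_le (min_le_left _ _)⟩)
      rw [h5] at this
      rwa [hu]
  have hlim : Tendsto (fun n => |G (u (n + 1)) - F (u (n + 1))|) atTop (𝓝 0) := by
    have := ((hG0.comp hu0').sub (hF0.comp hu0')).abs
    simpa using this
  have := ge_of_tendsto' hlim fun n => hd (n + 1)
  have h9 : |G x - F x| = 0 := le_antisymm this (abs_nonneg _)
  exact sub_eq_zero.1 (abs_eq_zero.1 h9)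

end Uniqueness

/-! ### Local inversion, extension of smoothness, and preimages on a graph. -/

section Assembly

variable {Φ : ℝ × ℝ → ℝ × ℝ} {μ lam : ℝ} {F G : ℝ → ℝ}

/-- The linear part `(x, y) ↦ (x, -y)`. -/
noncomputable def reflectSnd : (ℝ × ℝ) ≃L[ℝ] ℝ × ℝ :=
  (ContinuousLinearEquiv.refl ℝ ℝ).prodCongr (ContinuousLinearEquiv.neg ℝ)

theorem HasDegenerateForm.hasFDerivAt (hform : HasDegenerateForm Φ μ lam) :
    HasFDerivAt Φ (reflectSnd : ℝ × ℝ →L[ℝ] ℝ × ℝ) 0 := by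
  have hrem : ∀ {f : ℝ × ℝ → ℝ}, f =O[𝓝 0] (fun p => ‖p‖ ^ 3) →
      HasFDerivAt f (0 : ℝ × ℝ →L[ℝ] ℝ) 0 := fun hf =>
    IsBigO.hasFDerivAt (n := 3) (by simpa using hf) (by norm_num)
  have hx : HasFDerivAt (fun p : ℝ × ℝ => p.1) (.fst ℝ ℝ ℝ) 0 := hasFDerivAt_fst
  have hy : HasFDerivAt (fun p : ℝ × ℝ => p.2) (.snd ℝ ℝ ℝ) 0 := hasFDerivAt_snd
  have h1 := (hrem hform.1).fun_add ((hx.fun_add (HasFDerivAt.pow hx 2)).fun_add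
    (HasFDerivAt.fun_mul (HasFDerivAt.const_mul hx μ) hy))
  have h2 := (hrem hform.2).fun_add (hy.fun_neg.fun_add
    (HasFDerivAt.fun_mul (HasFDerivAt.const_mul hx lam) hy))
  refine HasFDerivAt.congr_of_eventuallyEq ((h1.prodMk h2).congr_fderiv ?_) (.of_forall fun p => ?_)
  · ext <;> simp [reflectSnd]
  · ext <;> simp

theorem HasDegenerateForm.map_zero (hform : HasDegenerateForm Φ μ lam) : Φ 0 = 0 := by
  have h1 := hform.1.eq_zero_imp.self_of_nhds
  have h2 := hform.2.eq_zero_imp.self_of_nhds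
  ext
  · simpa using h1
  · simpa using h2

theorem HasDegenerateForm.hasStrictFDerivAt (hΦ : ∀ᶠ p in 𝓝 0, ContDiffAt ℝ ∞ Φ p)
    (hform : HasDegenerateForm Φ μ lam) :
    HasStrictFDerivAt Φ (reflectSnd : ℝ × ℝ →L[ℝ] ℝ × ℝ) 0 :=
  hΦ.self_of_nhds.hasStrictFDerivAt' hform.hasFDerivAt (by simp)

theorem HasDegenerateForm.exists_inversionDomain {U : Set (ℝ × ℝ)} (hU : U ∈ 𝓝 0)
    (hΦ : ∀ᶠ p in 𝓝 0, ContDiffAt ℝ ∞ Φ p) (hform : HasDegenerateForm Φ μ lam) :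
    ∃ V, IsInversionDomain Φ U V := by
  have h := hform.hasStrictFDerivAt hΦ
  let e := h.toOpenPartialHomeomorph Φ
  refine ⟨e.source ∩ U, inter_mem (e.open_source.mem_nhds h.mem_toOpenPartialHomeomorph_source) hU,
    inter_subset_right, ?_⟩
  have := e.injOn
  rw [h.toOpenPartialHomeomorph_coe] at this
  exact this.mono inter_subset_left

/-- The cubic bound is only one-sided, but F is `C^1` across 0, so its right derivative determines
the full one. -/
theorem hasStrictDerivAt_of_isBigO_cube {δ : ℝ} (hδ : 0 < δ) (hF : ContDiffOn ℝ 1 F (Iio δ))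
    (hO : F =O[𝓝[≥] 0] fun x => x ^ 3) : HasStrictDerivAt F 0 0 := by
  have hs := (hF.contDiffAt (Iio_mem_nhds hδ)).hasStrictDerivAt one_ne_zero
  have hF0 : F 0 = 0 := by
    simpa using hO.eq_zero_imp.self_of_nhdsWithin (by simp)
  have hw : HasDerivWithinAt F 0 (Ici 0) 0 := by
    rw [hasDerivWithinAt_iff_isLittleO]
    have h1 : (fun x : ℝ => x ^ 3) =o[𝓝[≥] 0] fun x => x := by
      simpa using (isLittleO_pow_pow (𝕜 := ℝ) (m := 1) (n := 3) (by norm_num)).mono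
        nhdsWithin_le_nhds
    simpa [hF0] using hO.trans_isLittleO h1
  have := (uniqueDiffWithinAt_Ici (0 : ℝ)).eq_deriv _ hs.hasDerivAt.hasDerivWithinAt hw
  rwa [this] at hs

theorem exists_small_lipschitz (hF : HasStrictDerivAt F 0 0) {κ : ℝ} (hκ : 0 < κ) :
    ∃ δ > 0, ∀ s ∈ Ioo 0 δ, ∀ t ∈ Ioo 0 δ, |F s - F t| ≤ κ * |s - t| := by
  have h := (hasStrictFDerivAt_iff_isLittleO.1 hF.hasStrictFDerivAt).def hκ
  obtain ⟨δ, hδ, h⟩ := Metric.eventually_nhds_iff.1 h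
  refine ⟨δ, hδ, fun s hs t ht => ?_⟩
  have := @h (s, t) (by
    rw [Prod.dist_eq]
    simp only [Real.dist_eq, sub_zero, abs_of_pos hs.1, abs_of_pos ht.1]
    exact max_lt hs.2 ht.2)
  simpa using this

theorem cube_isLittleO_of_isBigO_cube (hO : F =O[𝓝[≥] 0] fun x => x ^ 3) :
    (fun x => F x ^ 3) =o[𝓝[>] 0] fun x => x ^ 2 := by
  have h1 := (hO.mono (nhdsWithin_mono _ Ioi_subset_Ici_self)).pow 3
  refine h1.trans_isLittleO ?_
  simpa only [← pow_mul] using pow_isLittleO_nhdsGT (m := 2) (n := 9) (by norm_num)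

/-- The abscissa map along the graph lies between x + x²/2 and x + 3x²/2, so the intermediate value
theorem on [X/2, X] applies. -/
theorem HasDegenerateForm.exists_preimage (hΦ : ∀ᶠ p in 𝓝 0, ContDiffAt ℝ ∞ Φ p)
    (hform : HasDegenerateForm Φ μ lam) (hF : ∀ᶠ x in 𝓝[>] 0, ContinuousAt F x)
    (hO : F =O[𝓝[≥] 0] fun x => x ^ 3)
    (hinv : ∀ᶠ x in 𝓝[>] 0, (Φ (x, F x)).2 = F (Φ (x, F x)).1) :
    ∃ δ > 0, ∀ X ∈ Ioo 0 δ, ∃ x ∈ Ioo 0 X, x + x ^ 2 / 2 ≤ X ∧ Φ (x, F x) = (X, F X) := by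
  have hF3 := cube_isLittleO_of_isBigO_cube hO
  have hpair := tendsto_pair_of_cube_isLittleO hF3
  have h1 := isLittleO_comp_graph hform.1 hF3
  have hO' : F =O[𝓝[>] 0] fun x => x ^ 3 := hO.mono (nhdsWithin_mono _ Ioi_subset_Ici_self)
  have h2 : (fun x => x * F x) =o[𝓝[>] 0] fun x => x ^ 2 := by
    refine ((isBigO_refl (fun x : ℝ => x) (𝓝[>] 0)).mul hO').trans_isLittleO ?_
    simpa only [← pow_succ'] using pow_isLittleO_nhdsGT (m := 2) (n := 4) (by norm_num)
  have h3 := (h1.add (h2.const_mul_left μ)).def (by norm_num : (0 : ℝ) < 1 / 2)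
  obtain ⟨δ, hδ, h⟩ := mem_nhdsGT_iff_exists_Ioo_subset.1
    (h3.and (hinv.and (hF.and (hpair.eventually hΦ))))
  have hδ : 0 < δ := hδ
  have hg : ∀ x ∈ Ioo 0 δ, x + x ^ 2 / 2 ≤ (Φ (x, F x)).1 ∧ (Φ (x, F x)).1 ≤ x + 3 / 2 * x ^ 2 := by
    intro x hx
    have := (h hx).1
    rw [Real.norm_eq_abs, Real.norm_eq_abs, abs_of_nonneg (sq_nonneg x), abs_le] at this
    constructor <;> linarith
  refine ⟨min δ (1 / 2), by positivity, fun X hX => ?_⟩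
  have hX0 := hX.1
  have hXδ := hX.2.trans_le (min_le_left _ _)
  have hX1 := hX.2.trans_le (min_le_right _ _)
  have hsub : ∀ x ∈ Icc (X / 2) X, x ∈ Ioo 0 δ := fun x hx =>
    ⟨by linarith [hx.1], by linarith [hx.2]⟩
  have hcont : ContinuousOn (fun x => (Φ (x, F x)).1) (Icc (X / 2) X) := fun x hx => by
    obtain ⟨-, -, h5, h6⟩ := h (hsub x hx)
    exact (continuous_fst.continuousAt.comp (ContinuousAt.comp (f := fun x => (x, F x))
      h6.continuousAt (continuousAt_id.prodMk h5))).continuousWithinAt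
  have e1 : (Φ (X / 2, F (X / 2))).1 ≤ X := by
    have := (hg (X / 2) (hsub _ ⟨le_rfl, by linarith⟩)).2
    nlinarith
  have e2 : X < (Φ (X, F X)).1 := by
    have := (hg X ⟨hX0, hXδ⟩).1
    nlinarith [pow_pos hX0 2]
  obtain ⟨x, hx, hxX⟩ := intermediate_value_Icc (by linarith) hcont ⟨e1, e2.le⟩
  simp only at hxX
  have hx' := hsub x hx
  refine ⟨x, ⟨hx'.1, lt_of_le_of_ne hx.2 ?_⟩, ?_, ?_⟩
  · rintro rfl
    exact e2.ne' hxX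
  · rw [← hxX]; exact (hg x hx').1
  · refine Prod.ext hxX ?_
    rw [(h hx').2.1, hxX]

/-- An invariant curve that agrees near `0` with smoother and smoother ones is smooth. -/
theorem contDiffAt_of_invariant {δ ε : ℝ} {k : ℕ} (hk : k ≠ 0) (hε : 0 < ε)
    (hloc : ∀ x ∈ Ioo 0 δ, x < ε → ContDiffAt ℝ k F x)
    (hΦ : ∀ x ∈ Ioo 0 δ, ContDiffAt ℝ ∞ Φ (x, F x))
    (hinv : ∀ x ∈ Ioo 0 δ, (Φ (x, F x)).2 = F (Φ (x, F x)).1)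
    (hreg : ∀ x ∈ Ioo 0 δ, deriv (fun x => (Φ (x, F x)).1) x ≠ 0)
    (hback : ∀ X ∈ Ioo 0 δ, ∃ x ∈ Ioo 0 X, x + x ^ 2 / 2 ≤ X ∧ Φ (x, F x) = (X, F X)) :
    ∀ x ∈ Ioo 0 δ, ContDiffAt ℝ k F x := by
  have hind : ∀ n : ℕ, ∀ x ∈ Ioo 0 δ, x < ε + n * (ε ^ 2 / 2) → ContDiffAt ℝ k F x := by
    intro n
    induction n with
    | zero => intro x hx hxε; exact hloc x hx (by simpa using hxε)
    | succ n ih =>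
      intro X hX hXε
      obtain ⟨x, hx, hxX, hΦx⟩ := hback X hX
      have hx' : x ∈ Ioo 0 δ := ⟨hx.1, hx.2.trans hX.2⟩
      have hFx : ContDiffAt ℝ k F x := by
        rcases lt_or_ge x ε with h | h
        · exact hloc x hx' h
        · refine ih x hx' ?_
          push_cast at hXε
          -- When x ≥ ε the backward step shortens the abscissa by at least ε²/2.
          nlinarith
      have hcomp : ContDiffAt ℝ k (fun x => Φ (x, F x)) x :=
        ContDiffAt.comp x ((hΦ x hx').of_le (by exact_mod_cast le_top)) (contDiffAt_id.prodMk hFx)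
      have := contDiffAt_of_comp (n := (k : ℕ∞)) (by exact_mod_cast hk) (G := F) hcomp.fst
        (hreg x hx') hcomp.snd (by
          filter_upwards [Ioo_mem_nhds hx'.1 hx'.2] with s hs using (hinv s hs).symm)
      rwa [hΦx] at this
  intro x hx
  obtain ⟨n, hn⟩ := exists_nat_gt (x / (ε ^ 2 / 2))
  refine hind n x hx ?_
  rw [div_lt_iff₀ (by positivity)] at hn
  linarith

/-- The inverse function theorem gives a preimage near 0, and backward invariance puts it on the
graph. The remaining issue is to exclude the abscissa 0, where nothing is assumed about G(0). -/
theorem HasDegenerateForm.exists_backward {V : Set (ℝ × ℝ)} (hV : V ∈ 𝓝 0)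
    (hΦ : ∀ᶠ p in 𝓝 0, ContDiffAt ℝ ∞ Φ p) (hform : HasDegenerateForm Φ μ lam) {δ : ℝ} (hδ : 0 < δ)
    (hsub : inverseImageOn Φ V ((Icc 0 δ).graphOn G) ⊆ (Icc 0 δ).graphOn G)
    (hG : (fun x => G x ^ 3) =o[𝓝[>] 0] fun x => x ^ 2) {ρ : ℝ} (hρ : 0 < ρ) :
    ∀ᶠ x in 𝓝[>] 0, ∃ x' ∈ Ioo 0 ρ, Φ (x', G x') = (x, G x) := by
  obtain ⟨C₁, hC₁, h1⟩ := hform.1.exists_nonneg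
  obtain ⟨C₂, hC₂, h2⟩ := hform.2.exists_nonneg
  have hsmall : ∀ᶠ p : ℝ × ℝ in 𝓝 0, C₂ * ‖p‖ ^ 2 < 1 / 2 := by
    have : Tendsto (fun p : ℝ × ℝ => C₂ * ‖p‖ ^ 2) (𝓝 0) (𝓝 0) :=
      (by fun_prop : Continuous fun p : ℝ × ℝ => C₂ * ‖p‖ ^ 2).tendsto' 0 0 (by simp)
    exact this.eventually_lt_const (by norm_num)
  have hW : {p | (p ∈ V ∧ p ∈ Metric.ball (0 : ℝ × ℝ) ρ) ∧ C₂ * ‖p‖ ^ 2 < 1 / 2 ∧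
      ‖(Φ p).1 - (p.1 + p.1 ^ 2 + μ * p.1 * p.2)‖ ≤ C₁ * ‖‖p‖ ^ 3‖ ∧
      ‖(Φ p).2 - (-p.2 + lam * p.1 * p.2)‖ ≤ C₂ * ‖‖p‖ ^ 3‖} ∈ 𝓝 (0 : ℝ × ℝ) :=
    inter_mem (inter_mem hV (Metric.ball_mem_nhds _ hρ))
      (hsmall.and ((isBigOWith_iff.1 h1).and (isBigOWith_iff.1 h2)))
  have himg := image_mem_map (m := Φ) hW
  rw [(hform.hasStrictFDerivAt hΦ).map_nhds_eq_of_equiv, hform.map_zero] at himg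
  have hG' := hG.trans (pow_isLittleO_nhdsGT (m := 1) (n := 2) (by norm_num))
  have hc : 0 < 1 / (8 * C₁ + 1) := by positivity
  filter_upwards [(tendsto_pair_of_cube_isLittleO hG).eventually himg, hG'.def hc,
    Ioo_mem_nhdsGT hδ] with x ⟨⟨a, b⟩, ⟨⟨hqV, hqρ⟩, hq1, hq2, hq3⟩, hq⟩ hx2 hx
  have hmem : (a, b) ∈ (Icc 0 δ).graphOn G := hsub ⟨hqV, by
    rw [hq]; exact mem_image_of_mem _ ⟨hx.1.le, hx.2.le⟩⟩
  rw [mem_graphOn] at hmem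
  obtain ⟨ha, hb⟩ := hmem
  simp only at ha hb
  subst hb
  have haρ : a < ρ := by
    rw [mem_ball_zero_iff] at hqρ
    exact (le_abs_self a).trans_lt ((norm_fst_le (a, G a)).trans_lt hqρ)
  refine ⟨a, ⟨lt_of_le_of_ne ha.1 ?_, haρ⟩, hq⟩
  -- If (0, G 0) mapped to (x, G x), the cubic remainders would give |G 0| ≤ 2|G x| and x ≤ 8C₁|G
  -- x|³, contradicting G³ = o(x).
  intro h0
  rw [← h0] at hq1 hq2 hq3 hq
  have hn : ‖((0 : ℝ), G 0)‖ = |G 0| := by simp [Prod.norm_def]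
  rw [hq, hn] at hq2 hq3
  rw [hn] at hq1
  simp only [Real.norm_eq_abs, abs_pow, abs_abs] at hq2 hq3
  simp only [mul_zero, zero_mul, add_zero, sub_neg_eq_add, ne_eq, OfNat.ofNat_ne_zero,
    not_false_eq_true, zero_pow, sub_zero] at hq2 hq3
  have e1 : |G 0| ≤ 2 * |G x| := by
    have e2 : C₂ * |G 0| ^ 3 ≤ |G 0| / 2 := by nlinarith [abs_nonneg (G 0)]
    have e3 : |G 0| ≤ |G x + G 0| + |G x| := by
      have := abs_sub (G x + G 0) (G x)
      rwa [add_sub_cancel_left] at this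
    linarith
  rw [abs_of_pos hx.1] at hq2
  have e4 : x ≤ 8 * C₁ * |G x| ^ 3 := by
    calc x ≤ C₁ * |G 0| ^ 3 := hq2
      _ ≤ C₁ * (2 * |G x|) ^ 3 := by gcongr
      _ = _ := by ring
  rw [Real.norm_eq_abs, abs_pow, pow_one, Real.norm_eq_abs, abs_of_pos hx.1,
    one_div_mul_eq_div, le_div_iff₀ (by positivity)] at hx2
  have hx0 := hx.1
  have e5 : 0 ≤ |G x| ^ 3 := by positivity
  have e6 : |G x| ^ 3 ≤ 0 := by linarith
  nlinarith

theorem cube_isLittleO_of_rpow_mul_tendsto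
    (h : Tendsto (fun x : ℝ => x ^ (-(2 / 3) : ℝ) * G x) (𝓝[>] 0) (𝓝 0)) :
    (fun x => G x ^ 3) =o[𝓝[>] 0] fun x => x ^ 2 := by
  refine (isLittleO_iff_tendsto' ?_).2 ?_
  · filter_upwards [self_mem_nhdsWithin] with x hx h0
    exact absurd h0 (pow_pos hx 2).ne'
  · have h3 := h.pow 3
    rw [zero_pow (by norm_num)] at h3
    refine h3.congr' ?_
    filter_upwards [self_mem_nhdsWithin] with x hx
    have hx : 0 < x := hx
    have : (x ^ (-(2 / 3) : ℝ)) ^ 3 = (x ^ 2)⁻¹ := by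
      rw [← Real.rpow_natCast, ← Real.rpow_mul hx.le, ← Real.rpow_natCast, ← Real.rpow_neg hx.le]
      norm_num
    rw [mul_pow, this]
    ring

end Assembly

/-! ### The main theorem. -/

theorem theorem1p1 (U : Set (ℝ × ℝ)) (hU : U ∈ 𝓝 (0 : ℝ × ℝ)) (Φ : ℝ × ℝ → ℝ × ℝ)
    (hΦ : ContDiffOn ℝ ∞ Φ U) (μ lam : ℝ) (hlam : 0 < lam) (hform : HasDegenerateForm Φ μ lam) :
    (∃ V : Set (ℝ × ℝ), IsInversionDomain Φ U V) ∧
    ∀ V : Set (ℝ × ℝ), IsInversionDomain Φ U V →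
      ∃ (δ : ℝ) (F : ℝ → ℝ), 0 < δ ∧ ContDiffOn ℝ ∞ F (Icc 0 δ) ∧
        (Icc 0 δ).graphOn F ⊆ U ∧
        -- Invariance
        ((Icc 0 δ).graphOn F ⊆ Φ '' V ∧
          inverseImageOn Φ V ((Icc 0 δ).graphOn F) ⊆ (Icc 0 δ).graphOn F) ∧
        -- Tangency
        F =O[𝓝[≥] 0] (fun x : ℝ => x ^ 3) ∧
        -- Uniqueness
        ∀ (δ' : ℝ) (F' : ℝ → ℝ), 0 < δ' →
          inverseImageOn Φ V ((Icc 0 δ').graphOn F') ⊆ (Icc 0 δ').graphOn F' →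
          Tendsto (fun x : ℝ => x ^ (-(2 / 3) : ℝ) * F' x) (𝓝[>] 0) (𝓝 0) →
          ∃ ε : ℝ, 0 < ε ∧ ε ≤ δ ∧ ε ≤ δ' ∧ EqOn F' F (Ioc 0 ε) ∧
            (F' 0 = 0 → EqOn F' F (Icc 0 ε)) := by
  have hsm : ∀ᶠ p in 𝓝 0, ContDiffAt ℝ ∞ Φ p := by
    filter_upwards [eventually_mem_nhds_iff.2 hU] with p hp using hΦ.contDiffAt hp
  refine ⟨hform.exists_inversionDomain hU hsm, fun V hV => ?_⟩
  have hzero : ∀ {H : ℝ → ℝ}, (H =O[𝓝[≥] 0] fun x => x ^ 3) → H 0 = 0 := fun h => by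
    simpa using h.eq_zero_imp.self_of_nhdsWithin (by simp)
  -- One derivative suffices for the small slope needed in uniqueness; higher smoothness is obtained
  -- by comparison with other curves.
  obtain ⟨F, ⟨δF, hδF, hFs⟩, hFO, hFinv⟩ := hform.exists_curve hsm hlam 1
  have hF0 : F 0 = 0 := hzero hFO
  have hFstrict := hasStrictDerivAt_of_isBigO_cube hδF (by exact_mod_cast hFs) hFO
  have hF3 := cube_isLittleO_of_isBigO_cube hFO
  have hunique : ∀ {G : ℝ → ℝ}, ((fun x => G x ^ 3) =o[𝓝[>] 0] fun x => x ^ 2) →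
      (∀ ρ > 0, ∀ᶠ x in 𝓝[>] 0, ∃ x' ∈ Ioo 0 ρ, Φ (x', G x') = (x, G x)) →
      ∀ᶠ x in 𝓝[>] 0, G x = F x := fun hG hback =>
    hform.eventually_eq_of_backward hsm hlam (fun κ hκ => exists_small_lipschitz hFstrict hκ) hF3
      hFinv hG hback
  have hcontAt : ∀ {H : ℝ → ℝ} {k : ℕ} {δ : ℝ}, 0 < δ → ContDiffOn ℝ k H (Iio δ) →
      ∀ᶠ x in 𝓝[>] 0, ContDiffAt ℝ k H x := fun hδ hH => by
    filter_upwards [Ioo_mem_nhdsGT hδ] with x hx using hH.contDiffAt (Iio_mem_nhds hx.2)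
  -- Smoother invariant curves have backward orbits of their own, so uniqueness identifies each with
  -- F near 0.
  have happrox : ∀ k : ℕ, ∃ H : ℝ → ℝ, ContDiffAt ℝ k H 0 ∧ H 0 = 0 ∧
      (∀ᶠ x in 𝓝[>] 0, ContDiffAt ℝ k H x) ∧ ∀ᶠ x in 𝓝[>] 0, H x = F x := by
    intro k
    obtain ⟨H, ⟨δH, hδH, hHs⟩, hHO, hHinv⟩ := hform.exists_curve hsm hlam k
    have hHc := hcontAt hδH hHs
    refine ⟨H, hHs.contDiffAt (Iio_mem_nhds hδH), hzero hHO, hHc,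
      hunique (cube_isLittleO_of_isBigO_cube hHO) fun ρ hρ => ?_⟩
    obtain ⟨δ, hδ, hpre⟩ :=
      hform.exists_preimage hsm (hHc.mono fun x hx => hx.continuousAt) hHO hHinv
    filter_upwards [Ioo_mem_nhdsGT (lt_min hδ hρ)] with x hx
    obtain ⟨x', hx', -, hΦx⟩ := hpre x ⟨hx.1, hx.2.trans_le (min_le_left _ _)⟩
    exact ⟨x', ⟨hx'.1, hx'.2.trans (hx.2.trans_le (min_le_right _ _))⟩, hΦx⟩
  have hFc := hcontAt hδF hFs
  obtain ⟨δ₀, hδ₀, hpre⟩ :=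
    hform.exists_preimage hsm (hFc.mono fun x hx => hx.continuousAt) hFO hFinv
  have hreg : ∀ᶠ x in 𝓝[>] 0, deriv (fun x => (Φ (x, F x)).1) x ≠ 0 := by
    have hFd : ContDiffAt ℝ 1 F 0 := by exact_mod_cast hFs.contDiffAt (Iio_mem_nhds hδF)
    have hg : ContDiffAt ℝ 1 (fun x => (Φ (x, F x)).1) 0 := by
      refine (ContDiffAt.comp (f := fun x => (x, F x)) (0 : ℝ) ?_ (contDiffAt_id.prodMk hFd)).fst
      rw [hF0]
      exact hsm.self_of_nhds.of_le (by exact_mod_cast le_top)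
    have hd : HasDerivAt (fun x => (Φ (x, F x)).1) 1 0 := by
      have h1 := HasFDerivAt.comp_hasDerivAt_of_eq (0 : ℝ) hform.hasFDerivAt
        ((hasDerivAt_id (0 : ℝ)).prodMk hFstrict.hasDerivAt) (by simp [hF0, ← Prod.zero_eq_mk])
      simpa [reflectSnd, Function.comp_def] using hasFDerivAt_fst.comp_hasDerivAt (0 : ℝ) h1
    have hc : ContinuousAt (deriv fun x => (Φ (x, F x)).1) 0 :=
      ((hg.fderiv_right (m := 0) (by simp)).clm_apply contDiffAt_const).continuousAt
    exact (hc.eventually_ne (by rw [hd.deriv]; exact one_ne_zero)).filter_mono nhdsWithin_le_nhds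
  have hpair := tendsto_pair_of_cube_isLittleO hF3
  obtain ⟨δ₁, hδ₁, hgood⟩ := mem_nhdsGT_iff_exists_Ioo_subset.1
    ((hpair.eventually (hsm.and hV.nhds_zero)).and (hFinv.and hreg))
  have hδ₁ : 0 < δ₁ := hδ₁
  have hδ₂ : 0 < min δ₀ δ₁ := lt_min hδ₀ hδ₁
  have hsub₀ : ∀ {x}, x ∈ Ioo 0 (min δ₀ δ₁) → x ∈ Ioo 0 δ₀ := fun hx =>
    ⟨hx.1, hx.2.trans_le (min_le_left _ _)⟩
  have hsub₁ : ∀ {x}, x ∈ Ioo 0 (min δ₀ δ₁) → x ∈ Ioo 0 δ₁ := fun hx =>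
    ⟨hx.1, hx.2.trans_le (min_le_right _ _)⟩
  -- Halving keeps the closed interval inside the open one; δ does not depend on the order of
  -- smoothness.
  set δ := min δ₀ δ₁ / 2 with hδ_def
  have hδ : 0 < δ := by positivity
  have hIoc : ∀ {x}, 0 < x → x ≤ δ → x ∈ Ioo 0 (min δ₀ δ₁) := fun h0 h1 => ⟨h0, by linarith⟩
  have hzeroV : ((0 : ℝ), F 0) ∈ V := by
    rw [hF0]; exact mem_of_mem_nhds hV.nhds_zero
  have hgraphV : (Icc 0 δ).graphOn F ⊆ V := by
    rintro _ ⟨x, hx, rfl⟩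
    rcases hx.1.eq_or_lt with rfl | h0
    · exact hzeroV
    · exact (hgood (hsub₁ (hIoc h0 hx.2))).1.2
  have hpreimage : ∀ X ∈ Icc 0 δ, ∃ x ∈ Icc 0 δ, Φ (x, F x) = (X, F X) := by
    intro X hX
    rcases hX.1.eq_or_lt with rfl | h0
    · exact ⟨0, hX, by rw [hF0]; exact hform.map_zero⟩
    · obtain ⟨x, hx, -, hΦx⟩ := hpre X (hsub₀ (hIoc h0 hX.2))
      exact ⟨x, ⟨hx.1.le, hx.2.le.trans hX.2⟩, hΦx⟩
  have hmem : ∀ x ∈ Icc 0 δ, (x, F x) ∈ (Icc 0 δ).graphOn F := fun x hx => mem_image_of_mem _ hx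
  refine ⟨δ, F, hδ, ?_, hgraphV.trans hV.subset, ⟨?_, ?_⟩, hFO, ?_⟩
  · rw [contDiffOn_infty]
    intro n x hx
    -- The order n + 1 is never 0, as the local inversion behind `contDiffAt_of_invariant` requires.
    obtain ⟨H, hH0, hHzero, hHs, hHF⟩ := happrox (n + 1)
    have hle : (n : WithTop ℕ∞) ≤ ((n + 1 : ℕ) : WithTop ℕ∞) := by exact_mod_cast Nat.le_succ n
    obtain ⟨ε, hε, hHε⟩ := mem_nhdsGT_iff_exists_Ioo_subset.1 (hHs.and hHF)
    have hε : 0 < ε := hε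
    rcases hx.1.eq_or_lt with rfl | h0
    · refine ((hH0.of_le hle).contDiffWithinAt).congr_of_eventuallyEq ?_ (by rw [hF0, hHzero])
      filter_upwards [self_mem_nhdsWithin, mem_nhdsWithin_of_mem_nhds (Iio_mem_nhds hε)]
        with s hs hsε
      rcases hs.1.eq_or_lt with rfl | h0
      · rw [hF0, hHzero]
      · exact (hHε ⟨h0, hsε⟩).2.symm
    · refine ContDiffAt.contDiffWithinAt (ContDiffAt.of_le ?_ hle)
      refine contDiffAt_of_invariant (Φ := Φ) (Nat.succ_ne_zero n) hε (fun s hs hsε => ?_)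
        (fun s hs => (hgood (hsub₁ hs)).1.1) (fun s hs => (hgood (hsub₁ hs)).2.1)
        (fun s hs => (hgood (hsub₁ hs)).2.2) (fun s hs => hpre s (hsub₀ hs)) x (hIoc h0 hx.2)
      refine (hHε ⟨hs.1, hsε⟩).1.congr_of_eventuallyEq ?_
      filter_upwards [Ioo_mem_nhds hs.1 hsε] with t ht using (hHε ht).2.symm
  · rintro _ ⟨X, hX, rfl⟩
    obtain ⟨x, hx, hΦx⟩ := hpreimage X hX
    exact ⟨(x, F x), hgraphV (hmem x hx), hΦx⟩
  · rintro q ⟨hqV, X, hX, hqX⟩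
    obtain ⟨x, hx, hΦx⟩ := hpreimage X hX
    -- Every point of the graph has a preimage on the graph; injectivity makes it the only one in V.
    rw [hV.injOn hqV (hgraphV (hmem x hx)) (by rw [hΦx, ← hqX])]
    exact hmem x hx
  · intro δ' F' hδ' hsub hlim
    have hF'3 := cube_isLittleO_of_rpow_mul_tendsto hlim
    obtain ⟨ε, hε, hεeq⟩ := mem_nhdsGT_iff_exists_Ioo_subset.1
      (hunique hF'3 fun ρ hρ => hform.exists_backward hV.nhds_zero hsm hδ' hsub hF'3 hρ)
    have hε : 0 < ε := hε
    have heq : EqOn F' F (Ioc 0 (min (ε / 2) (min δ δ'))) := fun x hx =>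
      hεeq ⟨hx.1, (hx.2.trans (min_le_left _ _)).trans_lt (by linarith)⟩
    refine ⟨min (ε / 2) (min δ δ'), by positivity, (min_le_right _ _).trans (min_le_left _ _),
      (min_le_right _ _).trans (min_le_right _ _), heq, fun h0 x hx => ?_⟩
    rcases hx.1.eq_or_lt with rfl | hpos
    · rw [h0, hF0]
    · exact heq ⟨hpos, hx.2⟩
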